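/- Let $m,n\ge 0$ be integers and $I=\{1,\dots,m+n-1\}$ (empty if $m+n\le 1$). For $i,j\in I$ put $i\bullet i=2$ if $i<m$, $i\bullet i=-2$ if $i>m$, $m\bullet m=0$; if $|i-j|=1$, put $i\bullet j=-1$ if $i<m$ or $j<m$, and $i\bullet j=1$ if $i>m$ or $j>m$; and $i\bullet j=0$ if $|i-j|>1$. Let $p(i)=0\in\mathbb Z/2$ for $i\ne m$ and $p(m)=1$. Extend $\bullet$ bilinearly and $p$ additively to $\mathbb N[I]$. Let $\mathbf f'$ be the free associative $\mathbb Q(q)$-algebra with $1$ on generators $\theta_i$, $i\in I$, graded by $\mathbb N[I]$ with $|\theta_i|=i$, and with parity $p(x)=p(|x|)$ for homogeneous $x$. Give $\mathbf f'\otimes\mathbf f'$ the associative product $$(x_1\otimes x_2)(x_1'\otimes x_2')=q^{-|x_2|\bullet|x_1'|}(-1)^{p(x_2)p(x_1')}\,x_1x_1'\otimes x_2x_2'$$ ($x_2$, $x_1'$ homogeneous), and let $\Delta:\mathbf f'\to\mathbf f'\otimes\mathbf f'$ be the algebra homomorphism with $\Delta(\theta_i)=\theta_i\otimes1+1\otimes\theta_i$.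 There is a unique bilinear form $(\,,)$ on $\mathbf f'$ with values in $\mathbb Q(q)$ such that $(1,1)=1$, $(x,y'y'')=(\Delta(x),y'\otimes y'')$, $(x'x'',y)=(x'\otimes x'',\Delta(y))$, $(\theta_i,\theta_i)=\frac1{1-q^{i\bullet i}}$ for $i\neq m$, $(\theta_m,\theta_m)=1$ if $m\in I$, and $(\theta_i,\theta_j)=0$ for $i\ne j$, where $(x'\otimes x'',y'\otimes y'')=(x',y')(x'',y'')$. Let $\mathcal I=\{x\in\mathbf f' : (x,y)=0\text{ for all }y\in\mathbf f'\}$ be its radical, which is a two-sided ideal, and let $\mathbf f=\mathbf f'/\mathcal I$. Let $\Delta^+$ be the set of positive roots $\alpha_i+\dots+\alpha_j$ with $i\le j$ in $I$; identify $\alpha_i$ with $i\in\mathbb N[I]$, so that $p(\alpha)$ and $\alpha\bullet\beta$ are defined for roots. Order $\Delta^+$ lexicographically: $$\alpha_1<\alpha_1+\alpha_2<\dots<\alpha_1+\dots+\alpha_{m+n-1}<\alpha_2<\alpha_2+\alpha_3<\dots<\alpha_{m+n-1}.$$ Define root vectors in $\mathbf f'$ by $\theta_{\alpha_i}=\theta_i$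 and, for $i<j$, $\alpha=\alpha_i+\dots+\alpha_j$ and $\alpha'=\alpha_i+\dots+\alpha_{j-1}$, $$\theta_\alpha=\theta_{\alpha'}\theta_j-(-1)^{p(\alpha')p(\alpha_j)}q^{\alpha'\bullet\alpha_j}\theta_j\theta_{\alpha'}.$$ Let $\mathcal J$ be the two-sided ideal of $\mathbf f'$ generated by the following elements (whenever all the indices that occur lie in $I$): (a) $(q+q^{-1})\theta_m\theta_{m-1}\theta_{m+1}\theta_m-\theta_{m-1}\theta_m\theta_{m+1}\theta_m-\theta_m\theta_{m-1}\theta_m\theta_{m+1}-\theta_m\theta_{m+1}\theta_m\theta_{m-1}-\theta_{m+1}\theta_m\theta_{m-1}\theta_m$; (b) $\theta_m^2$; (c) $\theta_i\theta_j-\theta_j\theta_i$ for $|i-j|>1$; (d) $(q+q^{-1})\theta_i\theta_{i\pm1}\theta_i-\theta_i^2\theta_{i\pm1}-\theta_{i\pm1}\theta_i^2$ for $i\ne m$. Then: (1) The images in $\mathbf f$ of the ordered products $\prod^{<}_{\alpha\in\Delta^+}\theta_\alpha^{n_\alpha}$ (factors in increasing order of $\alpha$ from left to right), where $n_\alpha\in\mathbb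 N$ if $p(\alpha)=0$ and $n_\alpha\in\{0,1\}$ if $p(\alpha)=1$, form a $\mathbb Q(q)$-basis of $\mathbf f$; distinct exponent families give distinct basis elements. (2) $\mathcal I=\mathcal J$. -/

import Mathlib

open scoped TensorProduct

noncomputable section

namespace SuperPBW

/-- The field `ℚ(q)`. -/
abbrev Kq : Type := RatFunc ℚ

/-- The indeterminate `q`. -/
def q : Kq := RatFunc.X

/-- The index set `I = {1, …, m+n-1}` (empty if `m + n ≤ 1`). -/
abbrev Idx (m n : ℕ) : Type := {i : ℕ // i ∈ Finset.Icc 1 (m + n - 1)}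

/-- The integers `i • j`, with `I' = {i < m}` and `I'' = {i > m}`. Two distinct neighbours `i, j`
never both equal `m`, so the last alternative for neighbours is the case `i ∈ I''` or `j ∈ I''`. -/
def dot (m i j : ℕ) : ℤ :=
  if i = j then (if i < m then 2 else if m < i then -2 else 0)
  else if i + 1 = j ∨ j + 1 = i then (if i < m ∨ j < m then -1 else 1)
  else 0

/-- The bilinear extension of `•` to `ℕ[I]`. -/
def bullet {m n : ℕ} (μ ν : Idx m n → ℕ) : ℤ :=
  ∑ i, ∑ j, (μ i : ℤ) * (ν j : ℤ) * dot m i j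

/-- The parity `p : ℕ[I] → ℤ/2`: the additive map with `p(i) = 0` for `i ≠ m` and `p(m) = 1`. -/
def parity {m n : ℕ} (ν : Idx m n → ℕ) : ZMod 2 :=
  ∑ i, (ν i : ZMod 2) * (if (i : ℕ) = m then 1 else 0)

/-- The scalar `(-1)^ε` for `ε ∈ ℤ/2`. -/
def sgn (ε : ZMod 2) : Kq := (-1) ^ ε.val

/-- The free algebra `f'` on `θ_i`, `i ∈ I`. -/
abbrev FPrime (m n : ℕ) : Type := FreeAlgebra Kq (Idx m n)

/-- The generator `θ_i`. -/
def θ {m n : ℕ} (i : Idx m n) : FPrime m n := FreeAlgebra.ι Kq i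

/-- The monomial `θ_{i₁} ⋯ θ_{i_r}` of a word. -/
def monomial {m n : ℕ} : FreeMonoid (Idx m n) →* FPrime m n := FreeMonoid.lift θ

/-- The weight `|θ_{i₁} ⋯ θ_{i_r}| ∈ ℕ[I]` of a monomial. -/
def weight {m n : ℕ} (w : FreeMonoid (Idx m n)) : Idx m n → ℕ := fun i => w.toList.count i

/-- The subspace `f'_ν` spanned by the monomials of weight `ν`. -/
def weightSpace {m n : ℕ} (ν : Idx m n → ℕ) : Submodule Kq (FPrime m n) :=
  Submodule.span Kq (monomial '' {w | weight w = ν})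

/-- The scalar `q^{-μ • ν} (-1)^{p(μ) p(ν)}`. -/
def twist {m n : ℕ} (μ ν : Idx m n → ℕ) : Kq :=
  q ^ (-bullet μ ν) * sgn (parity μ * parity ν)

/-! ### The twisted superalgebra `f' ⊗ f'` -/

/-- The vector space `f' ⊗ f'`, which carries the twisted multiplication below. -/
def TwistedSquare (m n : ℕ) : Type := FPrime m n ⊗[Kq] FPrime m n

instance (m n : ℕ) : AddCommGroup (TwistedSquare m n) :=
  inferInstanceAs (AddCommGroup (FPrime m n ⊗[Kq] FPrime m n))

instance (m n : ℕ) : Module Kq (TwistedSquare m n) :=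
  inferInstanceAs (Module Kq (FPrime m n ⊗[Kq] FPrime m n))

/-- The identity map from `f' ⊗ f'` to the twisted square. -/
def toTwisted (m n : ℕ) : (FPrime m n ⊗[Kq] FPrime m n) ≃ₗ[Kq] TwistedSquare m n :=
  LinearEquiv.refl Kq _

/-- The element `x ⊗ y` of the twisted square. -/
def tens {m n : ℕ} (x y : FPrime m n) : TwistedSquare m n := toTwisted m n (x ⊗ₜ[Kq] y)

/-- The basis of `f' ⊗ f'` consisting of tensor products of two monomials. -/
def pairBasis (m n : ℕ) :
    Module.Basis (FreeMonoid (Idx m n) × FreeMonoid (Idx m n)) Kq (TwistedSquare m n) :=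
  ((FreeAlgebra.basisFreeMonoid Kq (Idx m n)).tensorProduct
    (FreeAlgebra.basisFreeMonoid Kq (Idx m n))).map (toTwisted m n)

/-- The multiplication
`(x₁ ⊗ x₂)(y₁ ⊗ y₂) = q^{-|x₂| • |y₁|} (-1)^{p(x₂) p(y₁)} x₁ y₁ ⊗ x₂ y₂`,
given on monomials and extended bilinearly. -/
def twMul (m n : ℕ) :
    TwistedSquare m n →ₗ[Kq] TwistedSquare m n →ₗ[Kq] TwistedSquare m n :=
  (pairBasis m n).constr Kq fun x => (pairBasis m n).constr Kq fun y =>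
    twist (weight x.2) (weight y.1) •
      tens (monomial x.1 * monomial y.1) (monomial x.2 * monomial y.2)

section lemmas

variable {m n : ℕ}

lemma q_ne_zero : q ≠ 0 := RatFunc.X_ne_zero

lemma weight_one : weight (1 : FreeMonoid (Idx m n)) = 0 := by
  funext i; simp [weight]

lemma weight_mul (u v : FreeMonoid (Idx m n)) : weight (u * v) = weight u + weight v := by
  funext i; simp [weight]

lemma sgn_add (a b : ZMod 2) : sgn (a + b) = sgn a * sgn b := by
  have h : ∀ a b : ZMod 2, (a + b).val = (a.val + b.val) % 2 := by decide
  rw [sgn, h, ← neg_one_pow_eq_pow_mod_two, pow_add, sgn, sgn]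

lemma sgn_zero : sgn 0 = 1 := by simp [sgn]

lemma bullet_add_left (μ μ' ν : Idx m n → ℕ) :
    bullet (μ + μ') ν = bullet μ ν + bullet μ' ν := by
  simp only [bullet, ← Finset.sum_add_distrib]
  refine Finset.sum_congr rfl fun i _ => Finset.sum_congr rfl fun j _ => ?_
  simp only [Pi.add_apply]; push_cast; ring

lemma bullet_add_right (μ ν ν' : Idx m n → ℕ) :
    bullet μ (ν + ν') = bullet μ ν + bullet μ ν' := by
  simp only [bullet, ← Finset.sum_add_distrib]
  refine Finset.sum_congr rfl fun i _ => Finset.sum_congr rfl fun j _ => ?_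
  simp only [Pi.add_apply]; push_cast; ring

lemma parity_add (μ ν : Idx m n → ℕ) : parity (μ + ν) = parity μ + parity ν := by
  simp only [parity, ← Finset.sum_add_distrib]
  refine Finset.sum_congr rfl fun i _ => ?_
  simp only [Pi.add_apply]; push_cast; ring

lemma twist_add_left (μ μ' ν : Idx m n → ℕ) :
    twist (μ + μ') ν = twist μ ν * twist μ' ν := by
  simp only [twist, bullet_add_left, parity_add, add_mul, sgn_add, neg_add,
    zpow_add₀ q_ne_zero]
  ring

lemma twist_add_right (μ ν ν' : Idx m n → ℕ) :
    twist μ (ν + ν') = twist μ ν * twist μ ν' := by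
  simp only [twist, bullet_add_right, parity_add, mul_add, sgn_add, neg_add,
    zpow_add₀ q_ne_zero]
  ring

lemma twist_zero_left (ν : Idx m n → ℕ) : twist 0 ν = 1 := by
  simp [twist, bullet, parity, sgn_zero]

lemma twist_zero_right (μ : Idx m n → ℕ) : twist μ 0 = 1 := by
  simp [twist, bullet, parity, sgn_zero]

lemma basisFreeMonoid_eq (w : FreeMonoid (Idx m n)) :
    FreeAlgebra.basisFreeMonoid Kq (Idx m n) w = monomial w := by
  simp [FreeAlgebra.basisFreeMonoid, FreeAlgebra.equivMonoidAlgebraFreeMonoid, monomial]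
  rfl

lemma pairBasis_eq (x : FreeMonoid (Idx m n) × FreeMonoid (Idx m n)) :
    pairBasis m n x = tens (monomial x.1) (monomial x.2) := by
  rw [pairBasis, Module.Basis.map_apply, Module.Basis.tensorProduct_apply', basisFreeMonoid_eq,
    basisFreeMonoid_eq, tens]

lemma twMul_monomial (a b c d : FreeMonoid (Idx m n)) :
    twMul m n (tens (monomial a) (monomial b)) (tens (monomial c) (monomial d)) =
      twist (weight b) (weight c) • tens (monomial (a * c)) (monomial (b * d)) := by
  rw [← pairBasis_eq (a, b), ← pairBasis_eq (c, d), twMul, Module.Basis.constr_basis,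
    Module.Basis.constr_basis, map_mul, map_mul]

lemma twMul_assoc (x y z : TwistedSquare m n) :
    twMul m n (twMul m n x y) z = twMul m n x (twMul m n y z) := by
  have h1 (a b z) : twMul m n (twMul m n (pairBasis m n a) (pairBasis m n b)) z =
      twMul m n (pairBasis m n a) (twMul m n (pairBasis m n b) z) := by
    suffices h : twMul m n (twMul m n (pairBasis m n a) (pairBasis m n b)) =
        twMul m n (pairBasis m n a) ∘ₗ twMul m n (pairBasis m n b) from LinearMap.congr_fun h z
    refine (pairBasis m n).ext fun c => ?_
    simp only [pairBasis_eq, LinearMap.comp_apply, twMul_monomial, map_smul, LinearMap.smul_apply,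
      weight_mul, twist_add_left, twist_add_right, smul_smul, mul_assoc]
    congr 1
    ring
  have h2 (a y z) : twMul m n (twMul m n (pairBasis m n a) y) z =
      twMul m n (pairBasis m n a) (twMul m n y z) := by
    suffices h : (twMul m n).flip z ∘ₗ twMul m n (pairBasis m n a) =
        twMul m n (pairBasis m n a) ∘ₗ (twMul m n).flip z from LinearMap.congr_fun h y
    exact (pairBasis m n).ext fun b => h1 a b z
  suffices h : (twMul m n).flip z ∘ₗ (twMul m n).flip y = (twMul m n).flip (twMul m n y z) from
    LinearMap.congr_fun h x
  exact (pairBasis m n).ext fun a => h2 a y z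

lemma one_twMul (x : TwistedSquare m n) : twMul m n (tens 1 1) x = x := by
  suffices h : twMul m n (tens 1 1) = LinearMap.id by rw [h]; rfl
  refine (pairBasis m n).ext fun ⟨a, b⟩ => ?_
  rw [pairBasis_eq, ← map_one monomial, twMul_monomial]
  simp [weight_one, twist_zero_left]

lemma twMul_one (x : TwistedSquare m n) : twMul m n x (tens 1 1) = x := by
  suffices h : (twMul m n).flip (tens 1 1) = LinearMap.id by
    rw [← LinearMap.flip_apply, h]; rfl
  refine (pairBasis m n).ext fun ⟨a, b⟩ => ?_
  rw [pairBasis_eq, ← map_one monomial, LinearMap.flip_apply, twMul_monomial]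
  simp [weight_one, twist_zero_right]

end lemmas

instance (m n : ℕ) : Ring (TwistedSquare m n) :=
  { (inferInstance : AddCommGroup (TwistedSquare m n)) with
    mul := fun x y => twMul m n x y
    one := tens 1 1
    mul_assoc := twMul_assoc
    one_mul := one_twMul
    mul_one := twMul_one
    left_distrib := fun x y z => map_add (twMul m n x) y z
    right_distrib := fun x y z => LinearMap.map_add₂ (twMul m n) x y z
    zero_mul := fun x => LinearMap.map_zero₂ (twMul m n) x
    mul_zero := fun x => map_zero (twMul m n x) }

instance (m n : ℕ) : Algebra Kq (TwistedSquare m n) :=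
  Algebra.ofModule (fun r x y => LinearMap.map_smul₂ (twMul m n) r x y)
    (fun r x y => map_smul (twMul m n x) r y)

/-- On homogeneous elements the product is the one of the displayed formula. -/
lemma tens_mul_tens {m n : ℕ} {μ ν : Idx m n → ℕ} {x₂ y₁ : FPrime m n}
    (hx : x₂ ∈ weightSpace μ) (hy : y₁ ∈ weightSpace ν) (x₁ y₂ : FPrime m n) :
    tens x₁ x₂ * tens y₁ y₂ =
      (q ^ (-bullet μ ν) * sgn (parity μ * parity ν)) • tens (x₁ * y₁) (x₂ * y₂) := by
  have hspan (x : FPrime m n) : x ∈ Submodule.span Kq (Set.range (monomial (m := m) (n := n))) := by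
    have h := (FreeAlgebra.basisFreeMonoid Kq (Idx m n)).mem_span x
    rwa [show ⇑(FreeAlgebra.basisFreeMonoid Kq (Idx m n)) = monomial from
      funext basisFreeMonoid_eq] at h
  change twMul m n (tens x₁ x₂) (tens y₁ y₂) = twist μ ν • tens (x₁ * y₁) (x₂ * y₂)
  induction hspan x₁ using Submodule.span_induction with
  | zero => simp [tens]
  | add a b _ _ ha hb => simp_all [tens, TensorProduct.add_tmul, add_mul]
  | smul r a _ ha => simp_all [tens, ← TensorProduct.smul_tmul', smul_comm r]
  | mem a ha =>
  induction hspan y₂ using Submodule.span_induction with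
  | zero => simp [tens]
  | add a b _ _ ha hb => simp_all [tens, TensorProduct.tmul_add, mul_add]
  | smul r a _ ha => simp_all [tens, smul_comm r]
  | mem b hb =>
  induction hx using Submodule.span_induction with
  | zero => simp [tens]
  | add a b _ _ ha hb => simp_all [tens, TensorProduct.tmul_add, add_mul]
  | smul r a _ ha => simp_all [tens, smul_comm r]
  | mem c hc =>
  induction hy using Submodule.span_induction with
  | zero => simp [tens]
  | add a b _ _ ha hb => simp_all [tens, TensorProduct.add_tmul, mul_add]
  | smul r a _ ha => simp_all [tens, ← TensorProduct.smul_tmul', smul_comm r]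
  | mem d hd =>
  obtain ⟨a, rfl⟩ := ha
  obtain ⟨b, rfl⟩ := hb
  obtain ⟨c, rfl, rfl⟩ := hc
  obtain ⟨d, rfl, rfl⟩ := hd
  rw [twMul_monomial, map_mul, map_mul]

/-- The comultiplication: the algebra homomorphism `Δ : f' → f' ⊗ f'` into the twisted square with
`Δ(θ_i) = θ_i ⊗ 1 + 1 ⊗ θ_i`. -/
def Δ (m n : ℕ) : FPrime m n →ₐ[Kq] TwistedSquare m n :=
  FreeAlgebra.lift Kq fun i => tens (θ i) 1 + tens 1 (θ i)

/-! ### The bilinear form and its radical -/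

/-- The form on `f' ⊗ f'` induced by a form on `f'`:
`(x' ⊗ x'', y' ⊗ y'') = (x', y') (x'', y'')`. -/
def squareForm {m n : ℕ} (B : LinearMap.BilinForm Kq (FPrime m n)) :
    LinearMap.BilinForm Kq (TwistedSquare m n) :=
  (LinearMap.BilinForm.tmul B B).compl₁₂ (toTwisted m n).symm.toLinearMap
    (toTwisted m n).symm.toLinearMap

lemma squareForm_tens {m n : ℕ} (B : LinearMap.BilinForm Kq (FPrime m n))
    (x' x'' y' y'' : FPrime m n) :
    squareForm B (tens x' x'') (tens y' y'') = B x' y' * B x'' y'' := by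
  simp [squareForm, tens, mul_comm]

/-- The defining properties of the bilinear form `( , )` on `f'`. -/
structure IsLusztigForm {m n : ℕ} (B : LinearMap.BilinForm Kq (FPrime m n)) : Prop where
  one_one : B 1 1 = 1
  mul_right : ∀ x y' y'', B x (y' * y'') = squareForm B (Δ m n x) (tens y' y'')
  mul_left : ∀ x' x'' y, B (x' * x'') y = squareForm B (tens x' x'') (Δ m n y)
  theta_self : ∀ i : Idx m n, (i : ℕ) ≠ m → B (θ i) (θ i) = 1 / (1 - q ^ dot m i i)
  theta_odd : ∀ i : Idx m n, (i : ℕ) = m → B (θ i) (θ i) = 1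
  theta_ne : ∀ i j : Idx m n, i ≠ j → B (θ i) (θ j) = 0

lemma squareForm_eq_zero {m n : ℕ} (B : LinearMap.BilinForm Kq (FPrime m n))
    {x' x'' : FPrime m n} (h : B x' = 0 ∨ B x'' = 0) (t : TwistedSquare m n) :
    squareForm B (tens x' x'') t = 0 := by
  suffices h' : squareForm B (tens x' x'') = 0 by rw [h']; rfl
  refine (pairBasis m n).ext fun c => ?_
  rw [pairBasis_eq, squareForm_tens]
  rcases h with h | h <;> simp [h]

/-- The radical `{x ∈ f' | (x, y) = 0 for all y ∈ f'}` of the form, a two-sided ideal. -/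
def radical {m n : ℕ} {B : LinearMap.BilinForm Kq (FPrime m n)} (hB : IsLusztigForm B) :
    TwoSidedIdeal (FPrime m n) :=
  .mk' {x | ∀ y, B x y = 0}
    (fun y => by simp)
    (fun {x y} hx hy z => by simp [hx z, hy z])
    (fun {x} hx z => by simp [hx z])
    (fun {x y} hy z => by
      rw [hB.mul_left]
      exact squareForm_eq_zero B (.inr (LinearMap.ext hy)) _)
    (fun {x y} hx z => by
      rw [hB.mul_left]
      exact squareForm_eq_zero B (.inl (LinearMap.ext hx)) _)

lemma mem_radical {m n : ℕ} {B : LinearMap.BilinForm Kq (FPrime m n)} (hB : IsLusztigForm B)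
    (x : FPrime m n) : x ∈ radical hB ↔ ∀ y, B x y = 0 := by
  rw [radical, TwoSidedIdeal.mem_mk']
  rfl

/-- The algebra `f = f' / 𝓘`, where `𝓘` is the radical of the form. -/
abbrev FAlg {m n : ℕ} {B : LinearMap.BilinForm Kq (FPrime m n)} (hB : IsLusztigForm B) : Type :=
  (radical hB).ringCon.Quotient

/-- The quotient map `f' → f`. -/
def toFAlg {m n : ℕ} {B : LinearMap.BilinForm Kq (FPrime m n)} (hB : IsLusztigForm B) :
    FPrime m n →ₐ[Kq] FAlg hB :=
  (radical hB).ringCon.mkₐ Kq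

/-! ### Positive roots, root vectors and PBW monomials -/

/-- The positive root `α_i + ⋯ + α_j`, for `i ≤ j` in `I`, as the pair `(i, j)`. The order is
lexicographic:
`α_1 < α_1 + α_2 < ⋯ < α_1 + ⋯ + α_{m+n-1} < α_2 < α_2 + α_3 < ⋯ < α_{m+n-1}`. -/
abbrev PosRoot (m n : ℕ) : Type :=
  {α : Idx m n ×ₗ Idx m n // (ofLex α).1 ≤ (ofLex α).2}

/-- The element `i + (i+1) + ⋯ + j` of `ℕ[I]`. -/
def segment (m n i j : ℕ) : Idx m n → ℕ := fun k => if i ≤ k ∧ (k : ℕ) ≤ j then 1 else 0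

/-- The parity `p(α_i + ⋯ + α_j) = p(α_i) + ⋯ + p(α_j)` of a positive root. -/
def PosRoot.parity {m n : ℕ} (α : PosRoot m n) : ZMod 2 :=
  SuperPBW.parity (segment m n (ofLex α.1).1 (ofLex α.1).2)

/-- The generator with the natural number `k` as index (`0` if `k ∉ I`, which does not occur in
the root vectors of positive roots). -/
def gen (m n k : ℕ) : FPrime m n :=
  if h : k ∈ Finset.Icc 1 (m + n - 1) then θ ⟨k, h⟩ else 0

/-- The root vector of `α_i + ⋯ + α_{i+d}`: it is `θ_i` for `d = 0`, and for
`α = α' + α_j`, `α' = α_i + ⋯ + α_{j-1}`, it is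
`θ_α = θ_{α'} θ_j - (-1)^{p(α') p(α_j)} q^{α' • α_j} θ_j θ_{α'}`. -/
def rootVectorAux (m n i : ℕ) : ℕ → FPrime m n
  | 0 => gen m n i
  | d + 1 =>
    rootVectorAux m n i d * gen m n (i + d + 1) -
      (sgn (parity (segment m n i (i + d)) * parity (segment m n (i + d + 1) (i + d + 1))) *
        q ^ bullet (segment m n i (i + d)) (segment m n (i + d + 1) (i + d + 1))) •
      (gen m n (i + d + 1) * rootVectorAux m n i d)

/-- The root vector `θ_α` of a positive root. -/
def rootVector {m n : ℕ} (α : PosRoot m n) : FPrime m n :=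
  rootVectorAux m n (ofLex α.1).1 ((ofLex α.1).2 - (ofLex α.1).1 : ℕ)

/-- The exponents `(n_α)` with `n_α ∈ ℕ`, and `n_α ∈ {0, 1}` if `α` is odd. -/
abbrev PBWExponent (m n : ℕ) : Type :=
  {e : PosRoot m n → ℕ // ∀ α, α.parity = 1 → e α ≤ 1}

/-- The product of the `θ_α^{n_α}`, arranged from left to right in increasing order of `α`. -/
def pbwMonomial {m n : ℕ} (e : PosRoot m n → ℕ) : FPrime m n :=
  (((Finset.univ : Finset (PosRoot m n)).sort (· ≤ ·)).map fun α => rootVector α ^ e α).prod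

/-! ### The super Serre relations -/

/-- The super Serre relators. -/
inductive SerreRelator (m n : ℕ) : FPrime m n → Prop
  | quartic (a b c : Idx m n) (ha : (a : ℕ) + 1 = m) (hb : (b : ℕ) = m) (hc : (c : ℕ) = m + 1) :
      SerreRelator m n
        ((q + q⁻¹) • (θ b * θ a * θ c * θ b) - θ a * θ b * θ c * θ b - θ b * θ a * θ b * θ c
          - θ b * θ c * θ b * θ a - θ c * θ b * θ a * θ b)
  | square (b : Idx m n) (hb : (b : ℕ) = m) : SerreRelator m n (θ b ^ 2)
  | comm (i j : Idx m n) (hij : (i : ℕ) + 1 < j ∨ (j : ℕ) + 1 < i) :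
      SerreRelator m n (θ i * θ j - θ j * θ i)
  | cubic (i j : Idx m n) (hi : (i : ℕ) ≠ m) (hij : (i : ℕ) + 1 = j ∨ (j : ℕ) + 1 = i) :
      SerreRelator m n ((q + q⁻¹) • (θ i * θ j * θ i) - θ i ^ 2 * θ j - θ j * θ i ^ 2)

/-- The two-sided ideal `𝓙` of `f'` generated by the super Serre relators. -/
def serreIdeal (m n : ℕ) : TwoSidedIdeal (FPrime m n) :=
  TwoSidedIdeal.span {x | SerreRelator m n x}

end SuperPBW
end

noncomputable section

namespace SuperPBW

variable {m n : ℕ}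

/-! ### Induction principles -/

/-! Existence of the form comes from twisted derivations. Let `D_i` be the derivation removing a
letter `i`, and let `f'` act on itself from the right, with `θ_i` acting as `(θ_i, θ_i) D_i`.
Applying `y` to `x` and then the counit defines `(x, y)`. The compatibility with products in the
second variable holds because `Δ D_i = (D_i ⊗ 1) Δ` (`Δ_deriv`). In the first variable it is the
transpose of the twisted Leibniz rule (`form_mul_left`). Uniqueness is an induction on words.

The rest needs three facts.

The Serre ideal lies in the radical. By `mem_radical_of_deriv`, a relator without constant term is
in the radical once all its `D_i` are. For the quadratic and cubic relators these derivatives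
vanish, and for the quartic one they lie in the ideal generated by the quadratic ones.

Modulo the Serre ideal the PBW monomials span (`exists_sub_mem_serreIdeal`). Let `U` be the
subalgebra generated by the root vectors after `β`. The straightening needed is only `U θ_β ⊆ θ_β U
+ U`. The elements satisfying this form a subalgebra, so it is enough to treat single letters and
root vectors with the same first index (`moveSubalgebra_rootVector`). Odd root vectors square to
zero (`rootVec_mul_self`), which bounds their exponents.

The PBW monomials are pairwise orthogonal with nonzero norms (`form_pbwMonomial_ne_zero_iff`). If
`y` is a product of root vectors after `β`, then `Δ(θ_β^k y)` contains only one term whose first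
factor can pair with `θ_β`, namely a nonzero quantum integer times `θ_β ⊗ θ_β^(k-1) y`
(`Δ_rootVector_pow_mul`). Pairings can therefore be peeled off one root vector at a time.

Given `x` in the radical, subtract a PBW combination so that the difference lies in the Serre ideal.
The combination is then in the radical, so orthogonality makes it zero, and `x` is in the Serre
ideal. The same orthogonality gives linear independence in the quotient. -/

lemma span_range_monomial :
    Submodule.span Kq (Set.range (monomial (m := m) (n := n))) = ⊤ := by
  rw [← (FreeAlgebra.basisFreeMonoid Kq (Idx m n)).span_eq,
    show ⇑(FreeAlgebra.basisFreeMonoid Kq (Idx m n)) = monomial from funext basisFreeMonoid_eq]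

lemma linearMap_ext_monomial {M : Type*} [AddCommMonoid M] [Module Kq M]
    {f g : FPrime m n →ₗ[Kq] M} (h : ∀ w, f (monomial w) = g (monomial w)) : f = g :=
  (FreeAlgebra.basisFreeMonoid Kq (Idx m n)).ext fun w => by simpa [basisFreeMonoid_eq] using h w

lemma linearMap_ext_tens {M : Type*} [AddCommMonoid M] [Module Kq M]
    {f g : TwistedSquare m n →ₗ[Kq] M}
    (h : ∀ a b, f (tens (monomial a) (monomial b)) = g (tens (monomial a) (monomial b))) :
    f = g :=
  (pairBasis m n).ext fun w => by simpa [pairBasis_eq] using h w.1 w.2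

lemma monomial_of_mul (i : Idx m n) (w : FreeMonoid (Idx m n)) :
    monomial (FreeMonoid.of i * w) = θ i * monomial w := by
  rw [map_mul]; rfl

lemma FPrime.induction_left {P : FPrime m n → Prop} (one : P 1)
    (mul : ∀ i x, P x → P (θ i * x)) (add : ∀ x y, P x → P y → P (x + y))
    (smul : ∀ (r : Kq) x, P x → P (r • x)) (x : FPrime m n) : P x := by
  have hx : x ∈ Submodule.span Kq (Set.range (monomial (m := m) (n := n))) := by
    rw [span_range_monomial]; trivial
  have hw : ∀ w, P (monomial w) := fun w => by
    induction w using FreeMonoid.inductionOn' with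
    | one => simpa using one
    | of_mul i w ih => rw [monomial_of_mul]; exact mul _ _ ih
  induction hx using Submodule.span_induction with
  | mem x hx => obtain ⟨w, rfl⟩ := hx; exact hw w
  | zero => simpa using smul 0 1 one
  | add x y _ _ hx hy => exact add _ _ hx hy
  | smul r x _ hx => exact smul _ _ hx

/-! ### Weights -/

/-- The weight of a generator. -/
def simple (i : Idx m n) : Idx m n → ℕ := weight (FreeMonoid.of i)

lemma simple_apply (i j : Idx m n) : simple i j = if i = j then 1 else 0 := by
  simp [simple, weight, List.count_singleton, beq_iff_eq]

/-- Weights have natural number coefficients and cannot be subtracted freely. Arguments about `D_i`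
on weight `μ` therefore split: if `i` does not occur in `μ` the derivation vanishes
(`deriv_eq_zero`), and otherwise it lowers the weight by `i` (`deriv_mem`). -/
lemma exists_eq_simple_add {μ : Idx m n → ℕ} {i : Idx m n} (hi : μ i ≠ 0) :
    ∃ ν, μ = simple i + ν := by
  refine ⟨μ - simple i, funext fun k => ?_⟩
  simp only [Pi.add_apply, Pi.sub_apply, simple_apply]
  split_ifs with h
  · subst h; omega
  · omega

lemma weight_of_mul (i : Idx m n) (w : FreeMonoid (Idx m n)) :
    weight (FreeMonoid.of i * w) = simple i + weight w := weight_mul _ _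

lemma monomial_mem (w : FreeMonoid (Idx m n)) : monomial w ∈ weightSpace (weight w) :=
  Submodule.subset_span ⟨w, rfl, rfl⟩

lemma one_mem_weightSpace : (1 : FPrime m n) ∈ weightSpace (0 : Idx m n → ℕ) := by
  have := monomial_mem (1 : FreeMonoid (Idx m n))
  rwa [weight_one, map_one] at this

lemma theta_mem (i : Idx m n) : θ i ∈ weightSpace (simple i) := monomial_mem (FreeMonoid.of i)

lemma mul_mem_weightSpace {μ ν : Idx m n → ℕ} {x y : FPrime m n} (hx : x ∈ weightSpace μ)
    (hy : y ∈ weightSpace ν) : x * y ∈ weightSpace (μ + ν) := by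
  have : x * y ∈ weightSpace μ * weightSpace ν := Submodule.mul_mem_mul hx hy
  rw [weightSpace, weightSpace, Submodule.span_mul_span] at this
  refine Submodule.span_mono ?_ this
  rintro _ ⟨_, ⟨a, rfl, rfl⟩, _, ⟨b, rfl, rfl⟩, rfl⟩
  exact ⟨a * b, weight_mul a b, map_mul _ _ _⟩

lemma dot_comm (m i j : ℕ) : dot m i j = dot m j i := by
  unfold dot; split_ifs <;> first | rfl | omega

lemma bullet_comm (μ ν : Idx m n → ℕ) : bullet μ ν = bullet ν μ := by
  unfold bullet
  rw [Finset.sum_comm]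
  refine Finset.sum_congr rfl fun i _ => Finset.sum_congr rfl fun j _ => ?_
  rw [dot_comm]; ring

lemma twist_comm (μ ν : Idx m n → ℕ) : twist μ ν = twist ν μ := by
  unfold twist; rw [bullet_comm, mul_comm (parity μ)]

lemma tens_add_left (x y z : FPrime m n) : tens (x + y) z = tens x z + tens y z := by
  simp [tens, TensorProduct.add_tmul]

lemma tens_add_right (x y z : FPrime m n) : tens x (y + z) = tens x y + tens x z := by
  simp [tens, TensorProduct.tmul_add]

lemma tens_smul_left (r : Kq) (x y : FPrime m n) : tens (r • x) y = r • tens x y := by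
  simp [tens, ← TensorProduct.smul_tmul']

lemma tens_smul_right (r : Kq) (x y : FPrime m n) : tens x (r • y) = r • tens x y := by
  simp [tens]

lemma tens_zero_left (y : FPrime m n) : tens 0 y = 0 := by simp [tens]

lemma tens_zero_right (y : FPrime m n) : tens y 0 = 0 := by simp [tens]

lemma tens_mul_tens' {μ ν : Idx m n → ℕ} {x₂ y₁ : FPrime m n}
    (hx : x₂ ∈ weightSpace μ) (hy : y₁ ∈ weightSpace ν) (x₁ y₂ : FPrime m n) :
    tens x₁ x₂ * tens y₁ y₂ = twist μ ν • tens (x₁ * y₁) (x₂ * y₂) :=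
  tens_mul_tens hx hy x₁ y₂

lemma one_eq_tens : (1 : TwistedSquare m n) = tens 1 1 := rfl

lemma tens_one_mul_tens (x y z : FPrime m n) : tens x 1 * tens y z = tens (x * y) z := by
  suffices h : LinearMap.mulLeft Kq (tens x 1) =
      (toTwisted m n).toLinearMap ∘ₗ (LinearMap.mulLeft Kq x).rTensor _ ∘ₗ
        (toTwisted m n).symm.toLinearMap by
    simpa [tens] using LinearMap.congr_fun h (tens y z)
  refine linearMap_ext_tens fun a b => ?_
  simp only [LinearMap.mulLeft_apply]
  rw [tens_mul_tens' one_mem_weightSpace (monomial_mem a), twist_zero_left]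
  simp [tens]

lemma tens_mul_one_tens (x y z : FPrime m n) : tens x y * tens 1 z = tens x (y * z) := by
  suffices h : LinearMap.mulRight Kq (tens 1 z) =
      (toTwisted m n).toLinearMap ∘ₗ (LinearMap.mulRight Kq z).lTensor _ ∘ₗ
        (toTwisted m n).symm.toLinearMap by
    simpa [tens] using LinearMap.congr_fun h (tens x y)
  refine linearMap_ext_tens fun a b => ?_
  simp only [LinearMap.mulRight_apply]
  rw [tens_mul_tens' (monomial_mem b) one_mem_weightSpace, twist_zero_right]
  simp [tens]

lemma one_tens_mul_tens {μ ν : Idx m n → ℕ} {x y : FPrime m n} (hx : x ∈ weightSpace μ)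
    (hy : y ∈ weightSpace ν) (z : FPrime m n) :
    tens 1 x * tens y z = twist μ ν • tens y (x * z) := by
  rw [tens_mul_tens' hx hy, one_mul]

lemma Δ_theta (i : Idx m n) : Δ m n (θ i) = tens (θ i) 1 + tens 1 (θ i) := by
  simp [Δ, θ]

/-! ### Twisted derivations -/

/-- The value on a word of the twisted derivation removing the letter `i`. -/
def derivWord (i : Idx m n) : List (Idx m n) → FPrime m n
  | [] => 0
  | j :: w => (if i = j then (1 : Kq) else 0) • monomial (FreeMonoid.ofList w) +
      twist (simple i) (simple j) • (θ j * derivWord i w)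

/-- The twisted derivation `D_i` with `D_i(θ_j) = δ_{ij}` and
`D_i(xy) = D_i(x) y + q^{-i • |x|} (-1)^{p(i) p(x)} x D_i(y)`. -/
def deriv (i : Idx m n) : FPrime m n →ₗ[Kq] FPrime m n :=
  (FreeAlgebra.basisFreeMonoid Kq (Idx m n)).constr Kq fun w => derivWord i w.toList

lemma deriv_monomial (i : Idx m n) (w : FreeMonoid (Idx m n)) :
    deriv i (monomial w) = derivWord i w.toList := by
  rw [← basisFreeMonoid_eq, deriv, Module.Basis.constr_basis]

lemma deriv_one (i : Idx m n) : deriv i 1 = 0 := by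
  rw [← map_one monomial, deriv_monomial]; rfl

lemma deriv_theta_mul (i j : Idx m n) (x : FPrime m n) :
    deriv i (θ j * x) = (if i = j then (1 : Kq) else 0) • x +
      twist (simple i) (simple j) • (θ j * deriv i x) := by
  suffices h : deriv i ∘ₗ LinearMap.mulLeft Kq (θ j) = (if i = j then (1 : Kq) else 0) •
      LinearMap.id + twist (simple i) (simple j) • (LinearMap.mulLeft Kq (θ j) ∘ₗ deriv i) from
    LinearMap.congr_fun h x
  refine linearMap_ext_monomial fun w => ?_
  simp only [LinearMap.comp_apply, LinearMap.mulLeft_apply, LinearMap.add_apply,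
    LinearMap.smul_apply, LinearMap.id_apply]
  rw [← monomial_of_mul, deriv_monomial, deriv_monomial]
  rfl

lemma deriv_theta (i j : Idx m n) : deriv i (θ j) = (if i = j then (1 : Kq) else 0) • 1 := by
  simpa [deriv_one] using deriv_theta_mul i j 1

lemma deriv_mul {μ : Idx m n → ℕ} (i : Idx m n) {x : FPrime m n} (hx : x ∈ weightSpace μ)
    (y : FPrime m n) :
    deriv i (x * y) = deriv i x * y + twist (simple i) μ • (x * deriv i y) := by
  induction hx using Submodule.span_induction with
  | zero => simp
  | add a b _ _ ha hb => simp only [add_mul, map_add, ha, hb, smul_add]; abel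
  | smul r a _ ha => simp only [smul_mul_assoc, map_smul, ha, smul_add, smul_comm r]
  | mem x hx =>
    obtain ⟨w, rfl, rfl⟩ := hx
    induction w using FreeMonoid.inductionOn' with
    | one => simp [deriv_one, weight_one, twist_zero_right]
    | of_mul j w ih =>
      rw [monomial_of_mul, mul_assoc, deriv_theta_mul, ih, deriv_theta_mul, weight_of_mul,
        twist_add_right]
      simp only [mul_add, add_mul, smul_mul_assoc, mul_smul_comm, smul_add, smul_smul, mul_assoc,
        add_assoc]

lemma deriv_eq_zero {μ : Idx m n → ℕ} {i : Idx m n} (hi : μ i = 0) {x : FPrime m n}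
    (hx : x ∈ weightSpace μ) : deriv i x = 0 := by
  induction hx using Submodule.span_induction with
  | zero => simp
  | add a b _ _ ha hb => simp [ha, hb]
  | smul r a _ ha => simp [ha]
  | mem x hx =>
    obtain ⟨w, rfl, rfl⟩ := hx
    induction w using FreeMonoid.inductionOn' with
    | one => simp [deriv_one]
    | of_mul j w ih =>
      rw [weight_of_mul, Pi.add_apply, simple_apply] at hi
      have hij : i ≠ j := by rintro rfl; simp at hi
      rw [monomial_of_mul, deriv_theta_mul, ih (by omega)]
      simp [hij]

lemma deriv_mem {μ : Idx m n → ℕ} {i : Idx m n} {x : FPrime m n}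
    (hx : x ∈ weightSpace (simple i + μ)) : deriv i x ∈ weightSpace μ := by
  rw [weightSpace] at hx
  induction hx using Submodule.span_induction with
  | zero => simp
  | add a b _ _ ha hb => rw [map_add]; exact add_mem ha hb
  | smul r a _ ha => rw [map_smul]; exact Submodule.smul_mem _ _ ha
  | mem x hx =>
    obtain ⟨w, hw, rfl⟩ := hx
    induction w using FreeMonoid.inductionOn' generalizing μ with
    | one => simp [deriv_one]
    | of_mul j w ih =>
      simp only [Set.mem_ofPred_eq, weight_of_mul] at hw
      rw [monomial_of_mul, deriv_theta_mul]
      by_cases hij : i = j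
      · subst hij
        have hw' := add_left_cancel hw
        subst hw'
        refine add_mem (Submodule.smul_mem _ _ (monomial_mem w)) (Submodule.smul_mem _ _ ?_)
        by_cases h0 : weight w i = 0
        · rw [deriv_eq_zero h0 (monomial_mem w)]; simp
        · obtain ⟨ν, hν⟩ := exists_eq_simple_add h0
          rw [hν]
          exact mul_mem_weightSpace (theta_mem i) (ih hν)
      · rw [if_neg hij, zero_smul, zero_add]
        refine Submodule.smul_mem _ _ ?_
        have hj : μ j ≠ 0 := by
          have := congrFun hw j
          simp only [Pi.add_apply, simple_apply, if_neg hij, if_pos] at this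
          omega
        obtain ⟨ν, rfl⟩ := exists_eq_simple_add hj
        refine mul_mem_weightSpace (theta_mem j) (ih ?_)
        exact add_left_cancel (hw.trans (add_left_comm _ _ _))

/-! ### The bilinear form -/

/-- The scalars `(θ_i, θ_i)`. -/
def formCoeff (i : Idx m n) : Kq := if (i : ℕ) = m then 1 else 1 / (1 - q ^ dot m i i)

/-- The right action of `f'` on itself by the operators `(θ_i, θ_i) D_i`. -/
def derivAction (m n : ℕ) : FPrime m n →ₐ[Kq] (Module.End Kq (FPrime m n))ᵐᵒᵖ :=
  FreeAlgebra.lift Kq fun i => MulOpposite.op (formCoeff i • deriv i)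

/-- The counit. -/
def counit (m n : ℕ) : FPrime m n →ₐ[Kq] Kq := FreeAlgebra.algebraMapInv

lemma counit_theta (i : Idx m n) : counit m n (θ i) = 0 := by
  simp [counit, θ, FreeAlgebra.algebraMapInv]

/-- The form `( , )`. -/
def form (m n : ℕ) : LinearMap.BilinForm Kq (FPrime m n) :=
  LinearMap.mk₂ Kq (fun x y => counit m n ((derivAction m n y).unop x))
    (by simp) (by simp) (by simp) (by simp)

lemma form_apply_one (x : FPrime m n) : form m n x 1 = counit m n x := by simp [form]

/-- The action takes values in the opposite endomorphism ring, so the leftmost letter of the second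
argument acts first. Left multiplication by `θ_i` is thus adjoint to a multiple of `D_i`. -/
lemma form_theta_mul (i : Idx m n) (x y : FPrime m n) :
    form m n x (θ i * y) = formCoeff i * form m n (deriv i x) y := by
  simp [form, derivAction, θ]

lemma form_theta_right (i : Idx m n) (x : FPrime m n) :
    form m n x (θ i) = formCoeff i * counit m n (deriv i x) := by
  rw [← mul_one (θ i), form_theta_mul, form_apply_one]

lemma counit_eq_zero {μ : Idx m n → ℕ} (hμ : μ ≠ 0) {x : FPrime m n} (hx : x ∈ weightSpace μ) :
    counit m n x = 0 := by
  induction hx using Submodule.span_induction with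
  | zero => simp
  | add a b _ _ ha hb => simp [ha, hb]
  | smul r a _ ha => simp [ha]
  | mem x hx =>
    obtain ⟨w, rfl, rfl⟩ := hx
    induction w using FreeMonoid.inductionOn' with
    | one => exact absurd weight_one hμ
    | of_mul j w ih => simp [monomial_of_mul, counit_theta]

lemma form_eq_zero {μ ν : Idx m n → ℕ} (h : μ ≠ ν) {x y : FPrime m n} (hx : x ∈ weightSpace μ)
    (hy : y ∈ weightSpace ν) : form m n x y = 0 := by
  induction hy using Submodule.span_induction with
  | zero => simp
  | add a b _ _ ha hb => simp [ha, hb]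
  | smul r a _ ha => simp [ha]
  | mem y hy =>
    obtain ⟨w, rfl, rfl⟩ := hy
    induction w using FreeMonoid.inductionOn' generalizing μ x with
    | one => rw [map_one, form_apply_one]; rw [weight_one] at h; exact counit_eq_zero h hx
    | of_mul j w ih =>
      rw [monomial_of_mul, form_theta_mul]
      by_cases hj : μ j = 0
      · simp [deriv_eq_zero hj hx]
      · obtain ⟨ν, rfl⟩ := exists_eq_simple_add hj
        rw [ih (deriv_mem hx) fun h' => h (by rw [weight_of_mul, h']), mul_zero]

/-- The operator `D_i ⊗ 1`. -/
def derivLeft (i : Idx m n) : TwistedSquare m n →ₗ[Kq] TwistedSquare m n :=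
  (toTwisted m n).toLinearMap ∘ₗ (deriv i).rTensor _ ∘ₗ (toTwisted m n).symm.toLinearMap

lemma derivLeft_tens (i : Idx m n) (x y : FPrime m n) :
    derivLeft i (tens x y) = tens (deriv i x) y := by
  simp [derivLeft, tens]

/-- `D_i ⊗ 1` obeys the same Leibniz rule with respect to `Δ(θ_j)` as `D_i` does with respect to
`θ_j`. In the term coming from `1 ⊗ θ_j`, applying `D_i` to the first factor removes `i` from the
weight that `θ_j` has crossed; the lost scalar is restored by the symmetry of `twist`. -/
lemma derivLeft_Δ_theta_mul (i j : Idx m n) (t : TwistedSquare m n) :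
    derivLeft i (Δ m n (θ j) * t) = (if i = j then (1 : Kq) else 0) • t +
      twist (simple i) (simple j) • (Δ m n (θ j) * derivLeft i t) := by
  suffices h : derivLeft i ∘ₗ LinearMap.mulLeft Kq (Δ m n (θ j)) =
      (if i = j then (1 : Kq) else 0) • LinearMap.id +
        twist (simple i) (simple j) • (LinearMap.mulLeft Kq (Δ m n (θ j)) ∘ₗ derivLeft i) from
    LinearMap.congr_fun h t
  refine linearMap_ext_tens fun a b => ?_
  simp only [LinearMap.comp_apply, LinearMap.mulLeft_apply, LinearMap.add_apply,
    LinearMap.smul_apply, LinearMap.id_apply, Δ_theta, add_mul, map_add, derivLeft_tens,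
    tens_one_mul_tens, one_tens_mul_tens (theta_mem j) (monomial_mem a), deriv_theta_mul, map_smul,
    tens_add_left, tens_smul_left, smul_add, add_assoc]
  congr 2
  by_cases hi : weight a i = 0
  · simp [deriv_eq_zero hi (monomial_mem a), tens_zero_left]
  · obtain ⟨ν, hν⟩ := exists_eq_simple_add hi
    have ha := monomial_mem a
    rw [hν] at ha
    rw [one_tens_mul_tens (theta_mem j) (deriv_mem ha), hν, twist_add_right, smul_smul,
      twist_comm (simple j) (simple i)]

lemma Δ_deriv (i : Idx m n) (x : FPrime m n) : Δ m n (deriv i x) = derivLeft i (Δ m n x) := by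
  induction x using FPrime.induction_left with
  | one => rw [map_one (Δ m n), one_eq_tens, derivLeft_tens, deriv_one, tens_zero_left, map_zero]
  | mul j x ih =>
    rw [deriv_theta_mul, map_mul (Δ m n) (θ j) x, derivLeft_Δ_theta_mul, map_add, map_smul,
      map_smul, map_mul, ih]
  | add x y hx hy => simp only [map_add, hx, hy]
  | smul r x hx => simp only [map_smul, hx]

lemma squareForm_form_theta_mul (i : Idx m n) (t : TwistedSquare m n) (y z : FPrime m n) :
    squareForm (form m n) t (tens (θ i * y) z) =
      formCoeff i * squareForm (form m n) (derivLeft i t) (tens y z) := by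
  suffices h : (squareForm (form m n)).flip (tens (θ i * y) z) =
      formCoeff i • ((squareForm (form m n)).flip (tens y z) ∘ₗ derivLeft i) from
    LinearMap.congr_fun h t
  refine linearMap_ext_tens fun a b => ?_
  simp [squareForm_tens, form_theta_mul, derivLeft_tens, mul_assoc]

/-- This is the counit axiom `(ε ⊗ 1) Δ = 1`, since pairing with `1` is the counit `ε`. -/
lemma squareForm_form_Δ_one_tens (x z : FPrime m n) :
    squareForm (form m n) (Δ m n x) (tens 1 z) = form m n x z := by
  let T : TwistedSquare m n →ₗ[Kq] FPrime m n :=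
    (TensorProduct.lid Kq _).toLinearMap ∘ₗ ((counit m n).toLinearMap.rTensor _) ∘ₗ
      (toTwisted m n).symm.toLinearMap
  have hT (a b : FPrime m n) : T (tens a b) = counit m n a • b := by simp [T, tens]
  have h1 : (squareForm (form m n)).flip (tens 1 z) = (form m n).flip z ∘ₗ T :=
    linearMap_ext_tens fun a b => by simp [squareForm_tens, hT, form_apply_one]
  have h2 (i : Idx m n) (t) : T (Δ m n (θ i) * t) = θ i * T t := by
    suffices h : T ∘ₗ LinearMap.mulLeft Kq (Δ m n (θ i)) = LinearMap.mulLeft Kq (θ i) ∘ₗ T from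
      LinearMap.congr_fun h t
    refine linearMap_ext_tens fun a b => ?_
    simp only [LinearMap.comp_apply, LinearMap.mulLeft_apply, Δ_theta, add_mul, map_add,
      tens_one_mul_tens, one_tens_mul_tens (theta_mem i) (monomial_mem a), hT, map_mul,
      counit_theta, zero_mul, zero_smul, zero_add, map_smul]
    -- The twist disappears: it is `1` in weight zero, and the counit kills every other weight.
    by_cases h0 : weight a = 0
    · rw [h0, twist_zero_right, one_smul]
    · rw [counit_eq_zero h0 (monomial_mem a)]; simp
  have h3 : T (Δ m n x) = x := by
    induction x using FPrime.induction_left with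
    | one => rw [map_one, one_eq_tens, hT]; simp
    | mul j x ih => rw [map_mul, h2, ih]
    | add x y hx hy => simp only [map_add, hx, hy]
    | smul r x hx => simp only [map_smul, hx]
  calc _ = (squareForm (form m n)).flip (tens 1 z) (Δ m n x) := rfl
    _ = _ := by rw [h1, LinearMap.comp_apply, h3]; rfl

lemma form_mul_right (x y z : FPrime m n) :
    form m n x (y * z) = squareForm (form m n) (Δ m n x) (tens y z) := by
  induction y using FPrime.induction_left generalizing x with
  | one => rw [one_mul, squareForm_form_Δ_one_tens]
  | mul j y ih => rw [mul_assoc, form_theta_mul, ih, squareForm_form_theta_mul, Δ_deriv]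
  | add a b ha hb => simp only [add_mul, map_add, ha, hb, tens_add_left]
  | smul r a ha => simp only [smul_mul_assoc, map_smul, ha, tens_smul_left]

/-- Transposed form of the twisted Leibniz rule for `D_i` on a product. The left side produces the
twist by the weight of the tested element and the right side the twist by `μ`; where these weights
differ, orthogonality makes both terms zero. -/
lemma squareForm_form_Δ_theta_mul {μ : Idx m n → ℕ} (i : Idx m n) {x : FPrime m n}
    (hx : x ∈ weightSpace μ) (y : FPrime m n) (t : TwistedSquare m n) :
    squareForm (form m n) (tens x y) (Δ m n (θ i) * t) =
      formCoeff i * squareForm (form m n) (tens (deriv i x) y +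
        twist (simple i) μ • tens x (deriv i y)) t := by
  suffices h : squareForm (form m n) (tens x y) ∘ₗ LinearMap.mulLeft Kq (Δ m n (θ i)) =
      formCoeff i • squareForm (form m n) (tens (deriv i x) y +
        twist (simple i) μ • tens x (deriv i y)) from LinearMap.congr_fun h t
  refine linearMap_ext_tens fun a b => ?_
  simp only [LinearMap.comp_apply, LinearMap.mulLeft_apply, Δ_theta, add_mul, map_add,
    tens_one_mul_tens, one_tens_mul_tens (theta_mem i) (monomial_mem a), squareForm_tens, map_smul,
    form_theta_mul, LinearMap.smul_apply, LinearMap.add_apply, smul_eq_mul]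
  by_cases h : μ = weight a
  · rw [h]; ring
  · rw [form_eq_zero h hx (monomial_mem a)]; ring

lemma form_mul_left (x y z : FPrime m n) :
    form m n (x * y) z = squareForm (form m n) (tens x y) (Δ m n z) := by
  suffices h : ∀ w, form m n (monomial w * y) z =
      squareForm (form m n) (tens (monomial w) y) (Δ m n z) by
    have h' : (form m n).flip z ∘ₗ LinearMap.mulRight Kq y =
        (squareForm (form m n)).flip (Δ m n z) ∘ₗ (toTwisted m n).toLinearMap ∘ₗ
          (TensorProduct.mk Kq _ _).flip y := linearMap_ext_monomial h
    exact LinearMap.congr_fun h' x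
  -- The induction on `z` replaces `x` by `D_i x`, which is homogeneous but in general not a
  -- monomial.
  suffices h : ∀ (μ : Idx m n → ℕ), ∀ x ∈ weightSpace μ, form m n (x * y) z =
      squareForm (form m n) (tens x y) (Δ m n z) from fun w => h _ _ (monomial_mem w)
  induction z using FPrime.induction_left generalizing y with
  | one =>
    intro μ x hx
    rw [map_one (Δ m n), one_eq_tens, squareForm_tens, form_apply_one, form_apply_one, form_apply_one,
      map_mul]
  | mul i z ih =>
    intro μ x hx
    rw [form_theta_mul, deriv_mul i hx, map_mul (Δ m n), squareForm_form_Δ_theta_mul i hx]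
    congr 1
    simp only [map_add, map_smul, LinearMap.add_apply, LinearMap.smul_apply]
    rw [ih _ μ x hx]
    congr 1
    by_cases hi : μ i = 0
    · simp [deriv_eq_zero hi hx, tens_zero_left]
    · obtain ⟨ν, rfl⟩ := exists_eq_simple_add hi
      exact ih _ ν _ (deriv_mem hx)
  | add a b ha hb =>
    intro μ x hx
    simp only [map_add, ha y μ x hx, hb y μ x hx]
  | smul r a ha =>
    intro μ x hx
    simp only [map_smul, ha y μ x hx]

lemma form_theta_theta (i j : Idx m n) :
    form m n (θ i) (θ j) = if i = j then formCoeff i else 0 := by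
  rw [form_theta_right, deriv_theta]
  by_cases h : i = j
  · simp [h]
  · simp [h, Ne.symm h]

lemma form_isLusztigForm (m n : ℕ) : IsLusztigForm (form m n) where
  one_one := by rw [form_apply_one, map_one]
  mul_right := form_mul_right
  mul_left := form_mul_left
  theta_self i hi := by simp [form_theta_theta, formCoeff, hi]
  theta_odd i hi := by simp [form_theta_theta, formCoeff, hi]
  theta_ne i j hij := by simp [form_theta_theta, hij]

/-! ### Uniqueness of the form -/

namespace IsLusztigForm

variable {B B' : LinearMap.BilinForm Kq (FPrime m n)}

/-- Splitting `1 = 1 · 1` gives `(1, θ_i) = 2 (1, θ_i)`. -/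
lemma one_theta (hB : IsLusztigForm B) (i : Idx m n) : B 1 (θ i) = 0 := by
  have h := hB.mul_left 1 1 (θ i)
  simp only [Δ_theta, map_add, squareForm_tens, hB.one_one, mul_one] at h
  simpa using h

lemma one_eq (hB : IsLusztigForm B) (hB' : IsLusztigForm B') : B 1 = B' 1 := by
  ext x
  induction x using FPrime.induction_left with
  | one => rw [hB.one_one, hB'.one_one]
  | mul i x _ =>
    rw [hB.mul_right, hB'.mul_right, map_one, one_eq_tens, squareForm_tens, squareForm_tens,
      hB.one_theta, hB'.one_theta, zero_mul, zero_mul]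
  | add x y hx hy => simp only [map_add, hx, hy]
  | smul r x hx => simp only [map_smul, hx]

lemma theta_theta_eq (hB : IsLusztigForm B) (hB' : IsLusztigForm B') (i j : Idx m n) :
    B (θ i) (θ j) = B' (θ i) (θ j) := by
  by_cases hij : i = j
  · subst hij
    by_cases hi : (i : ℕ) = m
    · rw [hB.theta_odd i hi, hB'.theta_odd i hi]
    · rw [hB.theta_self i hi, hB'.theta_self i hi]
  · rw [hB.theta_ne i j hij, hB'.theta_ne i j hij]

lemma theta_eq (hB : IsLusztigForm B) (hB' : IsLusztigForm B') (i : Idx m n) :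
    B (θ i) = B' (θ i) := by
  ext x
  induction x using FPrime.induction_left with
  | one =>
    have h (C : LinearMap.BilinForm Kq (FPrime m n)) (hC : IsLusztigForm C) : C (θ i) 1 = 0 := by
      have h := hC.mul_right (θ i) 1 1
      simp only [Δ_theta, map_add, LinearMap.add_apply, squareForm_tens, hC.one_one, mul_one] at h
      simpa using h
    rw [h B hB, h B' hB']
  | mul j x hx =>
    rw [hB.mul_right, hB'.mul_right]
    simp only [Δ_theta, map_add, LinearMap.add_apply, squareForm_tens, hx,
      hB.theta_theta_eq hB', hB.one_eq hB']
  | add x y hx hy => simp only [map_add, hx, hy]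
  | smul r x hx => simp only [map_smul, hx]

lemma unique (hB : IsLusztigForm B) (hB' : IsLusztigForm B') : B = B' := by
  refine LinearMap.ext fun x => ?_
  induction x using FPrime.induction_left with
  | one => exact hB.one_eq hB'
  | mul i x hx =>
    ext y
    rw [hB.mul_left, hB'.mul_left]
    suffices h : squareForm B (tens (θ i) x) = squareForm B' (tens (θ i) x) by rw [h]
    refine linearMap_ext_tens fun a b => ?_
    rw [squareForm_tens, squareForm_tens, hx, hB.theta_eq hB']
  | add x y hx hy => simp only [map_add, hx, hy]
  | smul r x hx => simp only [map_smul, hx]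

end IsLusztigForm

/-! ### Symmetry of the form -/

lemma squareForm_flip (B : LinearMap.BilinForm Kq (FPrime m n)) :
    squareForm B.flip = (squareForm B).flip :=
  linearMap_ext_tens fun a b => linearMap_ext_tens fun c d => by
    rw [squareForm_tens]; exact (squareForm_tens B _ _ _ _).symm

/-- The flipped form satisfies the same axioms, so uniqueness applies. -/
lemma form_comm (x y : FPrime m n) : form m n x y = form m n y x := by
  have h : IsLusztigForm (form m n).flip :=
    { one_one := (form_isLusztigForm m n).one_one
      mul_right := fun x y z => by
        rw [squareForm_flip]
        exact form_mul_left y z x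
      mul_left := fun x y z => by
        rw [squareForm_flip]
        exact form_mul_right z x y
      theta_self := (form_isLusztigForm m n).theta_self
      theta_odd := (form_isLusztigForm m n).theta_odd
      theta_ne := fun i j hij => (form_isLusztigForm m n).theta_ne j i hij.symm }
  exact LinearMap.congr_fun₂ ((form_isLusztigForm m n).unique h) x y

/-- The `ℕ`-algebra structure of `ℚ(q)` in the form in which `match_scalars` looks for it. -/
abbrev natAlgebraKq : Algebra ℕ Kq := Semiring.toNatAlgebra

/-- The `ℤ`-algebra structure of `ℚ(q)` in the form in which `match_scalars` looks for it. -/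
abbrev intAlgebraKq : Algebra ℤ Kq := Ring.toIntAlgebra _

attribute [local instance] natAlgebraKq intAlgebraKq

/-! ### The super Serre relators lie in the radical -/

lemma bullet_simple_simple (i j : Idx m n) : bullet (simple i) (simple j) = dot m i j := by
  rw [bullet, Finset.sum_eq_single i, Finset.sum_eq_single j]
  · simp [simple_apply]
  · intro b _ hb; simp [simple_apply, Ne.symm hb]
  · simp
  · intro b _ hb; simp [simple_apply, Ne.symm hb]
  · simp

lemma parity_simple (i : Idx m n) : parity (simple i) = if (i : ℕ) = m then 1 else 0 := by
  rw [parity, Finset.sum_eq_single i]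
  · simp [simple_apply]
  · intro b _ hb; simp [simple_apply, Ne.symm hb]
  · simp

lemma sgn_one : sgn 1 = -1 := by
  rw [sgn, show (1 : ZMod 2).val = 1 from rfl, pow_one]

lemma twist_simple_simple (i j : Idx m n) :
    twist (simple i) (simple j) =
      q ^ (-dot m i j) * if (i : ℕ) = m ∧ (j : ℕ) = m then -1 else 1 := by
  rw [twist, bullet_simple_simple, parity_simple, parity_simple]
  split_ifs <;> simp_all [sgn_one, sgn_zero]

/-- A monomial other than `1` begins with some `θ_i`, and pairing with `θ_i y` sees `x` only through
`D_i x`. -/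
lemma mem_radical_of_deriv {x : FPrime m n} (h0 : counit m n x = 0)
    (h : ∀ i, deriv i x ∈ radical (form_isLusztigForm m n)) :
    x ∈ radical (form_isLusztigForm m n) := by
  rw [mem_radical]
  intro y
  induction y using FPrime.induction_left with
  | one => rw [form_apply_one, h0]
  | mul i y _ => rw [form_theta_mul, (mem_radical _ _).1 (h i) y, mul_zero]
  | add a b ha hb => rw [map_add, ha, hb, add_zero]
  | smul r a ha => rw [map_smul, ha, smul_zero]

lemma smul_mem_radical {x : FPrime m n} (r : Kq) (h : x ∈ radical (form_isLusztigForm m n)) :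
    r • x ∈ radical (form_isLusztigForm m n) := by
  rw [mem_radical] at h ⊢
  intro y; simp [h y]

lemma square_mem_radical (b : Idx m n) (hb : (b : ℕ) = m) :
    θ b * θ b ∈ radical (form_isLusztigForm m n) := by
  refine mem_radical_of_deriv (by simp [counit_theta]) fun i => ?_
  have : deriv i (θ b * θ b) = 0 := by
    rw [deriv_theta_mul, deriv_theta]
    by_cases hi : i = b
    · subst hi
      simp [twist_simple_simple, hb, dot]
    · simp [hi]
  rw [this]; exact zero_mem _

lemma comm_mem_radical (i j : Idx m n) (hij : (i : ℕ) + 1 < j ∨ (j : ℕ) + 1 < i) :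
    θ i * θ j - θ j * θ i ∈ radical (form_isLusztigForm m n) := by
  refine mem_radical_of_deriv (by simp [counit_theta]) fun k => ?_
  have hne : i ≠ j := by rintro rfl; omega
  have h1 : twist (simple i) (simple j) = 1 := by
    rw [twist_simple_simple, dot, if_neg (by omega), if_neg (by omega), if_neg (by omega)]; simp
  have h2 : twist (simple j) (simple i) = 1 := by rw [twist_comm, h1]
  have : deriv k (θ i * θ j - θ j * θ i) = 0 := by
    rw [map_sub, deriv_theta_mul, deriv_theta_mul, deriv_theta, deriv_theta]
    by_cases hi : k = i
    · subst hi; simp [hne, h1]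
    · by_cases hj : k = j
      · subst hj; simp [hi, h2]
      · simp [hi, hj]
  rw [this]; exact zero_mem _

lemma cubic_mem_radical (i j : Idx m n) (hi : (i : ℕ) ≠ m)
    (hij : (i : ℕ) + 1 = j ∨ (j : ℕ) + 1 = i) :
    (q + q⁻¹) • (θ i * θ j * θ i) - θ i ^ 2 * θ j - θ j * θ i ^ 2 ∈
      radical (form_isLusztigForm m n) := by
  refine mem_radical_of_deriv (by simp [counit_theta]) fun k => ?_
  have hq := q_ne_zero
  have hne : i ≠ j := by rintro rfl; omega
  -- With `ε = q` for `i < m` and `ε = q⁻¹` for `i > m`, both halves of the diagram become one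
  -- computation, because `q + q⁻¹` is symmetric.
  obtain ⟨ε, hε, h1, h2⟩ : ∃ ε : Kq, (ε = q ∨ ε = q⁻¹) ∧ twist (simple i) (simple j) = ε ∧
      twist (simple i) (simple i) = ε⁻¹ * ε⁻¹ := by
    rw [twist_simple_simple, twist_simple_simple, if_neg (by omega), if_neg (by omega)]
    rcases lt_or_gt_of_ne hi with h | h
    · refine ⟨q, .inl rfl, ?_, ?_⟩
      · rw [dot, if_neg (by omega), if_pos (by omega), if_pos (by omega)]; simp
      · simp only [dot, if_true, if_pos h]
        rw [zpow_neg, ← mul_inv, mul_one]; norm_cast; rw [pow_two]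
    · refine ⟨q⁻¹, .inr rfl, ?_, ?_⟩
      · rw [dot, if_neg (by omega), if_pos (by omega), if_neg (by omega)]; simp
      · simp only [dot, if_true, if_pos h, if_neg h.not_gt]
        simp [pow_two]
  have h3 : twist (simple j) (simple i) = ε := by rw [twist_comm, h1]
  have hε0 : ε ≠ 0 := by rcases hε with rfl | rfl <;> simp [hq]
  have hq2 : q + q⁻¹ = ε + ε⁻¹ := by rcases hε with rfl | rfl <;> simp [add_comm]
  rw [hq2]
  have : deriv k ((ε + ε⁻¹) • (θ i * θ j * θ i) - θ i ^ 2 * θ j - θ j * θ i ^ 2) = 0 := by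
    simp only [map_sub, map_smul, pow_two, mul_assoc, deriv_theta_mul, deriv_theta]
    by_cases hi : k = i
    · subst hi
      simp only [if_true, if_neg hne, h1, h2, mul_add, mul_smul_comm, smul_smul, mul_one,
        one_smul, zero_smul, zero_add, add_zero, smul_zero, mul_zero, smul_add]
      match_scalars <;> field_simp <;> ring
    · by_cases hj : k = j
      · subst hj
        simp only [if_true, if_neg hne.symm, h3, mul_smul_comm, smul_smul, mul_one,
          one_smul, zero_smul, smul_zero, zero_add, add_zero, mul_zero]
        match_scalars
        field_simp
        ring
      · simp [hi, hj]
  rw [this]; exact zero_mem _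

/-- The derivatives need not vanish in `f'`. Up to scalars, `D_a` gives `θ_b² θ_c + θ_c θ_b²`, `D_c`
gives `θ_b² θ_a + θ_a θ_b²`, and `D_b` gives the commutator of `θ_b` with `θ_a θ_c - θ_c θ_a`; all
lie in the ideal of the quadratic relators. -/
lemma quartic_mem_radical (a b c : Idx m n) (ha : (a : ℕ) + 1 = m) (hb : (b : ℕ) = m)
    (hc : (c : ℕ) = m + 1) :
    (q + q⁻¹) • (θ b * θ a * θ c * θ b) - θ a * θ b * θ c * θ b - θ b * θ a * θ b * θ c
      - θ b * θ c * θ b * θ a - θ c * θ b * θ a * θ b ∈ radical (form_isLusztigForm m n) := by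
  refine mem_radical_of_deriv (by simp [counit_theta]) fun k => ?_
  have hq := q_ne_zero
  have hab : a ≠ b := by rintro rfl; omega
  have hac : a ≠ c := by rintro rfl; omega
  have hbc : b ≠ c := by rintro rfl; omega
  have tab : twist (simple a) (simple b) = q := by
    rw [twist_simple_simple, dot, if_neg (by omega), if_pos (by omega), if_pos (by omega),
      if_neg (by omega)]; simp
  have tac : twist (simple a) (simple c) = 1 := by
    rw [twist_simple_simple, dot, if_neg (by omega), if_neg (by omega), if_neg (by omega)]; simp
  have tbc : twist (simple b) (simple c) = q⁻¹ := by
    rw [twist_simple_simple, dot, if_neg (by omega), if_pos (by omega), if_neg (by omega),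
      if_neg (by omega)]; simp
  have tbb : twist (simple b) (simple b) = -1 := by
    simp [twist_simple_simple, dot, hb]
  have tba := (twist_comm (simple b) (simple a)).trans tab
  have tca := (twist_comm (simple c) (simple a)).trans tac
  have tcb := (twist_comm (simple c) (simple b)).trans tbc
  have hsq := square_mem_radical b hb
  have hcm := comm_mem_radical a c (by omega)
  simp only [map_sub, map_smul, mul_assoc, deriv_theta_mul, deriv_theta]
  by_cases h : k = a
  · subst h
    convert smul_mem_radical (-q) (add_mem (TwoSidedIdeal.mul_mem_right _ _ (θ c) hsq)
      (TwoSidedIdeal.mul_mem_left _ (θ c) _ hsq)) using 1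
    simp only [if_true, if_neg hab, if_neg hac, tab, tac, mul_smul_comm, smul_smul,
      mul_one, one_smul, zero_smul, smul_zero, zero_add, add_zero, smul_add, mul_zero, mul_assoc]
    match_scalars <;> field_simp <;> ring
  · by_cases h' : k = c
    · subst h'
      convert smul_mem_radical (-q⁻¹) (add_mem (TwoSidedIdeal.mul_mem_right _ _ (θ a) hsq)
        (TwoSidedIdeal.mul_mem_left _ (θ a) _ hsq)) using 1
      simp only [if_true, if_neg hac.symm, if_neg hbc.symm, tca, tcb, mul_smul_comm,
        smul_smul, mul_one, one_smul, zero_smul, smul_zero, zero_add, add_zero, smul_add, mul_zero,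
        mul_assoc]
      match_scalars <;> field_simp <;> ring
    · by_cases h'' : k = b
      · subst h''
        convert add_mem (smul_mem_radical q⁻¹ (TwoSidedIdeal.mul_mem_right _ _ (θ k) hcm))
          (smul_mem_radical (-q⁻¹) (TwoSidedIdeal.mul_mem_left _ (θ k) _ hcm)) using 1
        simp only [if_true, if_neg hab.symm, if_neg hbc, tba, tbb, tbc, mul_add, mul_smul_comm,
          smul_smul, mul_one, one_smul, zero_smul, smul_zero, zero_add, add_zero, smul_add,
          mul_zero, mul_assoc, mul_sub, sub_mul]
        match_scalars <;> field_simp <;> ring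
      · simp only [if_neg h, if_neg h', if_neg h'', zero_smul, smul_zero, mul_zero, add_zero,
          sub_zero]
        exact zero_mem _

lemma serreRelator_mem_radical {x : FPrime m n} (hx : SerreRelator m n x) :
    x ∈ radical (form_isLusztigForm m n) := by
  cases hx with
  | quartic a b c ha hb hc => exact quartic_mem_radical a b c ha hb hc
  | square b hb => rw [pow_two]; exact square_mem_radical b hb
  | comm i j hij => exact comm_mem_radical i j hij
  | cubic i j hi hij => exact cubic_mem_radical i j hi hij

lemma serreIdeal_le_radical : serreIdeal m n ≤ radical (form_isLusztigForm m n) :=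
  TwoSidedIdeal.span_le.2 fun _ hx => serreRelator_mem_radical hx

/-! ### Root vectors in an algebra satisfying the super Serre relations -/

section QCommute

variable {K A : Type*} [Field K] [Ring A] [Algebra K A]

/-- The elements `x` and `y` commute up to the scalar `ξ`. -/
def QCommute (ξ : K) (x y : A) : Prop := x * y = ξ • (y * x)

/-- The `c`-commutator of `x` and `y`. -/
def qBracket (c : K) (x y : A) : A := x * y - c • (y * x)

lemma QCommute.symm {ξ : K} (hξ : ξ ≠ 0) {x y : A} (h : QCommute ξ x y) : QCommute ξ⁻¹ y x := by
  unfold QCommute at *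
  rw [h, smul_smul, inv_mul_cancel₀ hξ, one_smul]

lemma QCommute.bracket_right {ξ η : K} {x y z : A} (hy : QCommute ξ x y) (hz : QCommute η x z)
    (c : K) : QCommute (ξ * η) x (qBracket c y z) := by
  unfold QCommute qBracket at *
  have h1 : x * (y * z) = (ξ * η) • (y * z * x) := by
    rw [← mul_assoc, hy, smul_mul_assoc, mul_assoc, hz, mul_smul_comm, smul_smul, mul_assoc]
  have h2 : x * (z * y) = (ξ * η) • (z * y * x) := by
    rw [← mul_assoc, hz, smul_mul_assoc, mul_assoc, hy, mul_smul_comm, smul_smul, mul_assoc,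
      mul_comm η]
  rw [mul_sub, mul_smul_comm, h1, h2, sub_mul, smul_sub, smul_mul_assoc, smul_comm c]

lemma QCommute.bracket_left {ξ η : K} {x y z : A} (hx : QCommute ξ x z) (hy : QCommute η y z)
    (c : K) : QCommute (ξ * η) (qBracket c x y) z := by
  unfold QCommute qBracket at *
  have h1 : x * y * z = (ξ * η) • (z * (x * y)) := by
    rw [mul_assoc, hy, mul_smul_comm, ← mul_assoc, hx, smul_mul_assoc, smul_smul, mul_assoc,
      mul_comm η]
  have h2 : y * x * z = (ξ * η) • (z * (y * x)) := by
    rw [mul_assoc, hx, mul_smul_comm, ← mul_assoc, hy, smul_mul_assoc, smul_smul, mul_assoc]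
  rw [sub_mul, smul_mul_assoc, h1, h2, mul_sub, smul_sub, mul_smul_comm, smul_comm c]

/-- Both sides expand to the same four terms once `x` and `z` commute. This allows a root vector to
be cut in two. -/
lemma qBracket_assoc {x z : A} (h : QCommute (1 : K) x z) (y : A) (c d : K) :
    qBracket d (qBracket c x y) z = qBracket c x (qBracket d y z) := by
  unfold QCommute at h
  rw [one_smul] at h
  have h' (w : A) : x * (z * w) = z * (x * w) := by rw [← mul_assoc, h, mul_assoc]
  simp only [qBracket, mul_sub, sub_mul, mul_smul_comm, smul_mul_assoc, mul_assoc, smul_sub, h, h',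
    smul_smul, mul_comm d c]
  abel

/-- The relation `(q + q⁻¹) x y x = x² y + y x²`. -/
def CubicRel (q : K) (x y : A) : Prop := (q + q⁻¹) • (x * (y * x)) = x * (x * y) + y * (x * x)

/-- The relation is linear in `y` and survives multiplication of `y` on either side by an element
commuting with `x`. -/
lemma CubicRel.bracket_left {q : K} {x y z : A} (h : CubicRel q x y) (hz : QCommute (1 : K) z x)
    (c : K) : CubicRel q x (qBracket c z y) := by
  unfold CubicRel QCommute at *
  rw [one_smul] at hz
  have hz' (w : A) : z * (x * w) = x * (z * w) := by rw [← mul_assoc, hz, mul_assoc]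
  have h1 := congrArg (z * ·) h
  have h2 := congrArg (· * z) h
  simp only [mul_add, add_mul, mul_smul_comm, smul_mul_assoc, mul_assoc, hz'] at h1 h2
  simp only [qBracket, mul_sub, sub_mul, mul_smul_comm, smul_mul_assoc, mul_assoc, hz, hz',
    smul_sub, smul_comm (q + q⁻¹) c] at h1 h2 ⊢
  rw [h1, h2, smul_add]
  abel

/-- The cubic relation is an iterated bracket with scalars `c` and `c⁻¹` set to zero. Only `c + c⁻¹`
enters, so `c` may be `q` or `q⁻¹`. -/
lemma CubicRel.qCommute_right {q c : K} {x y : A} (h : CubicRel q x y) (hc : c ≠ 0)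
    (hqc : q + q⁻¹ = c + c⁻¹) : QCommute c⁻¹ (qBracket c y x) x := by
  unfold CubicRel QCommute qBracket at *
  rw [hqc] at h
  have h' : y * (x * x) = (c + c⁻¹) • (x * (y * x)) - x * (x * y) := by rw [h]; abel
  simp only [mul_sub, sub_mul, mul_smul_comm, smul_mul_assoc, mul_assoc, h', smul_sub, smul_smul]
  match_scalars <;> field_simp <;> ring

lemma CubicRel.qCommute_left {q c : K} {x y : A} (h : CubicRel q x y) (hc : c ≠ 0)
    (hqc : q + q⁻¹ = c + c⁻¹) : QCommute c⁻¹ x (qBracket c x y) := by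
  unfold CubicRel QCommute qBracket at *
  rw [hqc] at h
  have h' : x * (x * y) = (c + c⁻¹) • (x * (y * x)) - y * (x * x) := by rw [h]; abel
  simp only [mul_sub, sub_mul, mul_smul_comm, smul_mul_assoc, mul_assoc, h', smul_sub, smul_smul]
  match_scalars <;> field_simp <;> ring

/-- The odd counterpart: only `x y x` survives on either side. -/
lemma qCommute_right_of_sq_eq_zero {c : K} {x : A} (h : x * x = 0) (y : A) :
    QCommute (-c) (qBracket c y x) x := by
  have h' (w : A) : x * (x * w) = 0 := by rw [← mul_assoc, h, zero_mul]
  simp [QCommute, qBracket, mul_sub, sub_mul, mul_assoc, h, h']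

lemma qCommute_left_of_sq_eq_zero {c : K} {x : A} (h : x * x = 0) (y : A) :
    QCommute (-c) x (qBracket c x y) := by
  have h' (w : A) : x * (x * w) = 0 := by rw [← mul_assoc, h, zero_mul]
  simp [QCommute, qBracket, mul_sub, sub_mul, mul_assoc, h, h']

/-- The middle letter of three consecutive even ones commutes with their root vector. -/
lemma qCommute_middle {q c : K} {x y z : A} (hc : c ≠ 0) (hqc : q + q⁻¹ = c + c⁻¹)
    (hq : q + q⁻¹ ≠ 0) (hxz : x * z = z * x) (hx : CubicRel q y x) (hz : CubicRel q y z) :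
    QCommute (1 : K) y (qBracket c (qBracket c x y) z) := by
  unfold CubicRel QCommute qBracket at *
  have h0 (w : A) : x * (z * w) = z * (x * w) := by rw [← mul_assoc, hxz, mul_assoc]
  -- The cubic relations are solved for `y x y` and `y z y`. After substitution the discrepancy has
  -- the factor `1 + c² - c (q + q⁻¹)`, which is zero.
  have h1 : y * (x * y) = (q + q⁻¹)⁻¹ • (y * (y * x) + x * (y * y)) := by
    rw [← hx, smul_smul, inv_mul_cancel₀ hq, one_smul]
  have h1' (w : A) : y * (x * (y * w)) =
      (q + q⁻¹)⁻¹ • (y * (y * (x * w)) + x * (y * (y * w))) := by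
    simpa [mul_assoc, add_mul] using congrArg (· * w) h1
  have h2 : y * (z * y) = (q + q⁻¹)⁻¹ • (y * (y * z) + z * (y * y)) := by
    rw [← hz, smul_smul, inv_mul_cancel₀ hq, one_smul]
  have h2' (w : A) : y * (z * (y * w)) =
      (q + q⁻¹)⁻¹ • (y * (y * (z * w)) + z * (y * (y * w))) := by
    simpa [mul_assoc, add_mul] using congrArg (· * w) h2
  have hc2 : c ^ 2 + 1 ≠ 0 := by
    rw [hqc] at hq
    intro h
    apply hq
    field_simp
    rw [h, mul_zero]
  simp only [mul_sub, sub_mul, mul_smul_comm, smul_mul_assoc, mul_assoc, hxz, h0, h1, h1', h2, h2',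
    smul_sub, smul_add, mul_add, smul_smul]
  rw [hqc]
  match_scalars <;> field_simp <;> ring

/-- The quartic relation as the anticommutation of the middle letter with a root vector. -/
lemma qCommute_middle_odd {q : K} {x y z : A} (hq : q ≠ 0) (hxz : x * z = z * x)
    (hy : y * y = 0) (h : (q + q⁻¹) • (y * (x * (z * y))) = x * (y * (z * y)) + y * (x * (y * z)) +
      y * (z * (y * x)) + z * (y * (x * y))) :
    QCommute (-1 : K) y (qBracket q (qBracket q⁻¹ x y) z) := by
  unfold QCommute qBracket at *
  have h0 (w : A) : x * (z * w) = z * (x * w) := by rw [← mul_assoc, hxz, mul_assoc]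
  have h1 (w : A) : y * (y * w) = 0 := by rw [← mul_assoc, hy, zero_mul]
  have h2 : x * (y * (z * y)) = (q + q⁻¹) • (y * (x * (z * y))) - y * (x * (y * z)) -
      y * (z * (y * x)) - z * (y * (x * y)) := by rw [h]; abel
  simp only [mul_sub, sub_mul, mul_smul_comm, smul_mul_assoc, mul_assoc, hxz, h0, hy, h1, h2,
    smul_sub, smul_smul, mul_zero, smul_zero]
  match_scalars <;> field_simp <;> ring

/-- The hypothesis `h` expands to the cubic relation. Multiplying it by `y` on the right and using
it once more gives `x y x y = y x y x`. The square of the bracket is then `1 + q⁻² - q⁻¹ (q + q⁻¹) =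
0` times `y x y x`. -/
lemma qBracket_mul_self_of_right {q : K} {x y : A} (hq : q ≠ 0) (hq2 : q + q⁻¹ ≠ 0)
    (hy : y * y = 0) (h : QCommute q x (qBracket q⁻¹ x y)) :
    qBracket q⁻¹ x y * qBracket q⁻¹ x y = 0 := by
  unfold QCommute qBracket at *
  have h1 (w : A) : y * (y * w) = 0 := by rw [← mul_assoc, hy, zero_mul]
  have h2 : x * (x * y) = (q + q⁻¹) • (x * (y * x)) - y * (x * x) := by
    simp only [mul_sub, sub_mul, mul_smul_comm, smul_mul_assoc, mul_assoc, smul_sub, smul_smul,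
      mul_inv_cancel₀ hq, one_smul] at h
    rw [sub_eq_iff_eq_add] at h
    rw [h, add_smul]; abel
  have h3 : x * (y * (x * y)) = y * (x * (y * x)) := by
    have h4 : (q + q⁻¹) • (x * (y * (x * y))) - y * (x * (x * y)) = 0 := by
      calc _ = ((q + q⁻¹) • (x * (y * x)) - y * (x * x)) * y := by
            simp only [sub_mul, smul_mul_assoc, mul_assoc]
        _ = 0 := by rw [← h2, mul_assoc, mul_assoc, hy, mul_zero, mul_zero]
    rw [h2, mul_sub, h1, sub_zero, mul_smul_comm] at h4
    have h5 := sub_eq_zero.1 h4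
    exact smul_right_injective A hq2 h5
  simp only [mul_sub, sub_mul, mul_smul_comm, smul_mul_assoc, mul_assoc, h1, h2, h3, mul_zero,
    smul_zero, smul_sub, smul_smul]
  match_scalars
  field_simp
  ring

/-- Multiplying the cubic relation by `x` on either side expresses `x y x y` and `y x y x` through
`x y² x`. The resulting coefficient `(1 + q²) / (q + q⁻¹) - q` is zero. -/
lemma qBracket_mul_self_of_left {q : K} {x y : A} (hq : q ≠ 0) (hq2 : q + q⁻¹ ≠ 0)
    (hx : x * x = 0) (h : CubicRel q y x) : qBracket q x y * qBracket q x y = 0 := by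
  unfold CubicRel at h
  have h1 (w : A) : x * (x * w) = 0 := by rw [← mul_assoc, hx, zero_mul]
  have h2 : x * (y * (x * y)) = (q + q⁻¹)⁻¹ • (x * (y * (y * x))) := by
    have h3 := congrArg (x * ·) h
    simp only [mul_add, mul_smul_comm, h1, add_zero] at h3
    rw [← h3, smul_smul, inv_mul_cancel₀ hq2, one_smul]
  have h3 : y * (x * (y * x)) = (q + q⁻¹)⁻¹ • (x * (y * (y * x))) := by
    have h3 := congrArg (· * x) h
    simp only [add_mul, smul_mul_assoc, mul_assoc, hx, mul_zero, zero_add] at h3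
    rw [← h3, smul_smul, inv_mul_cancel₀ hq2, one_smul]
  have hc2 : q ^ 2 + 1 ≠ 0 := by
    intro h
    apply hq2
    field_simp
    rw [h, mul_zero]
  simp only [qBracket, mul_sub, sub_mul, mul_smul_comm, smul_mul_assoc, mul_assoc, h1, h2, h3,
    mul_zero, smul_zero, smul_sub, smul_smul]
  match_scalars
  field_simp
  ring

end QCommute

/-! ### Commutation relations and squares of root vectors -/

section SerreSystem

variable {K A : Type*} [Field K] [Ring A] [Algebra K A]

/-- A family of elements satisfying the super Serre relations. -/
structure SerreSystem (m : ℕ) (q : K) (g : ℕ → A) : Prop where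
  q_ne_zero : q ≠ 0
  q_add_inv_ne_zero : q + q⁻¹ ≠ 0
  comm : ∀ i j, i + 1 < j → g i * g j = g j * g i
  square : g m * g m = 0
  cubic : ∀ i j, i ≠ m → i + 1 = j ∨ j + 1 = i → CubicRel q (g i) (g j)
  quartic : ∀ k, k + 1 = m → (q + q⁻¹) • (g m * (g k * (g (m + 1) * g m))) =
    g k * (g m * (g (m + 1) * g m)) + g m * (g k * (g m * g (m + 1))) +
      g m * (g (m + 1) * (g m * g k)) + g (m + 1) * (g m * (g k * g m))

/-- The scalar `q ^ ((j - 1) • j)`. -/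
def braidCoeff (m : ℕ) (q : K) (j : ℕ) : K := if j ≤ m then q⁻¹ else q

/-- The root vector of `α_s + ⋯ + α_{s+d}` built from the family `g`. -/
def rootVecAux (m : ℕ) (q : K) (g : ℕ → A) (s : ℕ) : ℕ → A
  | 0 => g s
  | d + 1 => qBracket (braidCoeff m q (s + d + 1)) (rootVecAux m q g s d) (g (s + d + 1))

/-- The root vector of `α_s + ⋯ + α_j` built from the family `g`. -/
def rootVec (m : ℕ) (q : K) (g : ℕ → A) (s j : ℕ) : A := rootVecAux m q g s (j - s)

variable {m : ℕ} {q : K} {g : ℕ → A}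

lemma rootVec_self (s : ℕ) : rootVec m q g s s = g s := by simp [rootVec, rootVecAux]

lemma rootVec_succ {s j : ℕ} (h : s ≤ j) : rootVec m q g s (j + 1) =
    qBracket (braidCoeff m q (j + 1)) (rootVec m q g s j) (g (j + 1)) := by
  obtain ⟨d, rfl⟩ := Nat.exists_eq_add_of_le h
  simp [rootVec, show s + d + 1 - s = d + 1 by omega, rootVecAux]

namespace SerreSystem

lemma braidCoeff_ne_zero (H : SerreSystem m q g) (j : ℕ) : braidCoeff m q j ≠ 0 := by
  unfold braidCoeff; split_ifs
  · exact inv_ne_zero H.q_ne_zero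
  · exact H.q_ne_zero

lemma q_add_inv_eq (j : ℕ) : q + q⁻¹ = braidCoeff m q j + (braidCoeff m q j)⁻¹ := by
  unfold braidCoeff; split_ifs
  · rw [inv_inv, add_comm]
  · rfl

lemma rootVec_far {s j k : ℕ} (H : SerreSystem m q g) (hs : s ≤ j) (hk : j + 1 < k) :
    QCommute (1 : K) (rootVec m q g s j) (g k) := by
  induction j, hs using Nat.le_induction with
  | base => rw [rootVec_self, QCommute, one_smul]; exact H.comm _ _ hk
  | succ j hj ih =>
    rw [rootVec_succ hj]
    have h : QCommute (1 : K) (g (j + 1)) (g k) := by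
      rw [QCommute, one_smul]; exact H.comm _ _ hk
    simpa using (ih (by omega)).bracket_left h _

/-- Among the letters of the root vector only the last one fails to commute with `g (k + 1)`. -/
lemma rootVec_cubic {s k : ℕ} (H : SerreSystem m q g) (hs : s ≤ k) (hk : k + 1 ≠ m) :
    CubicRel q (g (k + 1)) (rootVec m q g s k) := by
  induction k, hs using Nat.le_induction with
  | base => rw [rootVec_self]; exact H.cubic _ _ hk (.inr rfl)
  | succ j hj ih =>
    rw [rootVec_succ hj]
    exact (H.cubic _ _ hk (.inr rfl)).bracket_left (H.rootVec_far hj (by omega)) _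

lemma rootVec_last {s k : ℕ} (H : SerreSystem m q g) (hs : s ≤ k) :
    ∃ ξ : K, ξ ≠ 0 ∧ QCommute ξ (rootVec m q g s (k + 1)) (g (k + 1)) := by
  rw [rootVec_succ hs]
  have hc := H.braidCoeff_ne_zero (k + 1)
  by_cases hk : k + 1 = m
  · refine ⟨_, neg_ne_zero.2 hc, qCommute_right_of_sq_eq_zero ?_ _⟩
    rw [hk]; exact H.square
  · exact ⟨_, inv_ne_zero hc, (H.rootVec_cubic hs hk).qCommute_right hc (q_add_inv_eq _)⟩

/-- For `k + 1 = m` this is the quartic relation, used nowhere else. Otherwise `k + 1` and `k + 2`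
lie on the same side of the threshold in `braidCoeff`, so both brackets carry the same scalar. -/
lemma rootVec_middle_triple (H : SerreSystem m q g) (k : ℕ) :
    QCommute (if k + 1 = m then -1 else 1 : K) (g (k + 1)) (rootVec m q g k (k + 2)) := by
  rw [rootVec_succ (by omega), rootVec_succ le_rfl, rootVec_self]
  split_ifs with hk
  · have h1 : braidCoeff m q (k + 1) = q⁻¹ := if_pos (by omega)
    have h2 : braidCoeff m q (k + 1 + 1) = q := if_neg (by omega)
    rw [h1, h2]
    refine qCommute_middle_odd H.q_ne_zero (H.comm _ _ (by omega)) (hk ▸ H.square) ?_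
    have := H.quartic k hk
    rwa [← hk] at this
  · have h1 : braidCoeff m q (k + 1 + 1) = braidCoeff m q (k + 1) := by
      unfold braidCoeff
      congr 1
      simp only [eq_iff_iff]
      omega
    rw [h1]
    exact qCommute_middle (H.braidCoeff_ne_zero _) (q_add_inv_eq _) H.q_add_inv_ne_zero
      (H.comm _ _ (by omega)) (H.cubic _ _ hk (.inr rfl)) (H.cubic _ _ hk (.inl rfl))

/-- Letters at distance at least two commute with `g k`, so everything reduces to the three letters
around `k`. The base case isolates this window on the left, and the induction appends commuting
letters on the right. -/
lemma rootVec_middle {s k j : ℕ} (H : SerreSystem m q g) (hs : s < k) (hk : k < j) :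
    QCommute (if k = m then -1 else 1 : K) (g k) (rootVec m q g s j) := by
  obtain ⟨k, rfl⟩ : ∃ k', k = k' + 1 := ⟨k - 1, by omega⟩
  replace hk : k + 2 ≤ j := hk
  induction j, hk using Nat.le_induction with
  | base =>
    rcases (Nat.lt_succ_iff.1 hs).eq_or_lt with rfl | hs
    · exact H.rootVec_middle_triple s
    · obtain ⟨l, rfl⟩ : ∃ l, k = l + 1 := ⟨k - 1, by omega⟩
      have h1 := H.rootVec_far (s := s) (j := l) (k := l + 2) (by omega) (by omega)
      have h2 := H.rootVec_far (s := s) (j := l) (k := l + 3) (by omega) (by omega)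
      have h3 := H.rootVec_middle_triple (l + 1)
      have h4 : rootVec m q g s (l + 1 + 2) = qBracket (braidCoeff m q (l + 1))
          (rootVec m q g s l) (rootVec m q g (l + 1) (l + 1 + 2)) := by
        rw [rootVec_succ (by omega), rootVec_succ (by omega), rootVec_succ (by omega),
          qBracket_assoc h1, qBracket_assoc h2, rootVec_succ (by omega), rootVec_succ le_rfl,
          rootVec_self]
      rw [h4]
      have h1' := h1.symm one_ne_zero
      rw [inv_one] at h1'
      simpa using h1'.bracket_right h3 _
  | succ j hj ih =>
    rw [rootVec_succ (by omega)]
    have h : QCommute (1 : K) (g (k + 1)) (g (j + 1)) := by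
      rw [QCommute, one_smul]; exact H.comm _ _ (by omega)
    simpa using ih.bracket_right h _

/-- In the inductive step the shorter vector is bracketed from the previous one, which commutes with
the longer vector up to `ξ`, and an interior letter, which does so up to a sign. The exact value `ξ
= q` below `m` is recorded because `rootVec_mul_self` needs it. -/
lemma rootVec_adjacent {s j : ℕ} (H : SerreSystem m q g) (hs : s ≤ j) :
    ∃ ξ : K, ξ ≠ 0 ∧ (j < m → ξ = q) ∧
      QCommute ξ (rootVec m q g s j) (rootVec m q g s (j + 1)) := by
  induction j, hs using Nat.le_induction with
  | base =>
    rw [rootVec_succ le_rfl, rootVec_self]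
    have hc := H.braidCoeff_ne_zero (s + 1)
    by_cases hsm : s = m
    · exact ⟨_, neg_ne_zero.2 hc, fun h => by omega,
        qCommute_left_of_sq_eq_zero (hsm ▸ H.square) _⟩
    · refine ⟨_, inv_ne_zero hc, fun h => ?_,
        (H.cubic s (s + 1) hsm (.inl rfl)).qCommute_left hc (q_add_inv_eq _)⟩
      rw [braidCoeff, if_pos (by omega), inv_inv]
  | succ j hj ih =>
    obtain ⟨ξ, hξ, hξm, h⟩ := ih
    have h1 := h.bracket_right (H.rootVec_far hj (show j + 1 < j + 2 by omega))
      (braidCoeff m q (j + 1 + 1))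
    rw [← rootVec_succ (by omega)] at h1
    have h2 := H.rootVec_middle (s := s) (k := j + 1) (j := j + 1 + 1) (by omega) (by omega)
    refine ⟨_, ?_, fun hm => ?_, (rootVec_succ (m := m) (q := q) (g := g) hj) ▸
      h1.bracket_left h2 (braidCoeff m q (j + 1))⟩
    · rw [mul_one]
      refine mul_ne_zero hξ ?_
      split_ifs <;> simp
    · rw [hξm (by omega), if_neg (by omega), mul_one, mul_one]

lemma rootVec_row {s j l : ℕ} (H : SerreSystem m q g) (hs : s ≤ j) (hl : j < l) :
    ∃ ξ : K, ξ ≠ 0 ∧ QCommute ξ (rootVec m q g s j) (rootVec m q g s l) := by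
  replace hl : j + 1 ≤ l := hl
  induction l, hl using Nat.le_induction with
  | base =>
    obtain ⟨ξ, hξ, -, h⟩ := H.rootVec_adjacent hs
    exact ⟨ξ, hξ, h⟩
  | succ l hl ih =>
    obtain ⟨ξ, hξ, h⟩ := ih
    rw [rootVec_succ (by omega)]
    exact ⟨_, by simpa using hξ, h.bracket_right (H.rootVec_far hs (by omega)) _⟩

lemma rootVec_mul_self {s j : ℕ} (H : SerreSystem m q g) (hs : s ≤ m) (hj : m ≤ j) :
    rootVec m q g s j * rootVec m q g s j = 0 := by
  induction j, hj using Nat.le_induction with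
  | base =>
    rcases hs.eq_or_lt with rfl | hs
    · rw [rootVec_self]; exact H.square
    · obtain ⟨k, rfl⟩ : ∃ k, m = k + 1 := ⟨m - 1, by omega⟩
      obtain ⟨ξ, -, hξ, h⟩ := H.rootVec_adjacent (s := s) (j := k) (by omega)
      rw [hξ (by omega), rootVec_succ (by omega), braidCoeff, if_pos le_rfl] at h
      rw [rootVec_succ (by omega), braidCoeff, if_pos le_rfl]
      exact qBracket_mul_self_of_right H.q_ne_zero H.q_add_inv_ne_zero H.square h
  | succ j hj ih =>
    rw [rootVec_succ (by omega), braidCoeff, if_neg (by omega)]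
    exact qBracket_mul_self_of_left H.q_ne_zero H.q_add_inv_ne_zero ih
      (H.rootVec_cubic (by omega) (by omega))

end SerreSystem

end SerreSystem

/-! ### Weights of root vectors -/

lemma segment_self {k : ℕ} (hk : k ∈ Finset.Icc 1 (m + n - 1)) :
    segment m n k k = simple ⟨k, hk⟩ := by
  funext l
  rw [simple_apply, segment]
  congr 1
  rw [Subtype.ext_iff, eq_iff_iff]
  constructor
  · rintro ⟨h, h'⟩; exact le_antisymm h h'
  · rintro rfl; exact ⟨le_rfl, le_rfl⟩

lemma segment_succ {i j : ℕ} (h : i ≤ j + 1) :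
    segment m n i (j + 1) = segment m n i j + segment m n (j + 1) (j + 1) := by
  funext l
  simp only [segment, Pi.add_apply]
  split_ifs <;> omega

lemma gen_mem (k : ℕ) : gen m n k ∈ weightSpace (segment m n k k) := by
  unfold gen
  split_ifs with h
  · rw [segment_self h]; exact theta_mem _
  · exact zero_mem _

lemma rootVectorAux_mem (i d : ℕ) :
    rootVectorAux m n i d ∈ weightSpace (segment m n i (i + d)) := by
  induction d with
  | zero => exact gen_mem i
  | succ d ih =>
    rw [rootVectorAux, ← add_assoc, segment_succ (by omega)]
    refine sub_mem (mul_mem_weightSpace ih (gen_mem _)) (Submodule.smul_mem _ _ ?_)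
    rw [add_comm]
    exact mul_mem_weightSpace (gen_mem _) ih

lemma parity_segment {i j : ℕ} (hi : 1 ≤ i) (hj : j ≤ m + n - 1) :
    parity (segment m n i j) = if i ≤ m ∧ m ≤ j then 1 else 0 := by
  unfold parity segment
  split_ifs with h
  · rw [Finset.sum_eq_single ⟨m, Finset.mem_Icc.2 ⟨by omega, by omega⟩⟩]
    · simp [h]
    · intro k _ hk
      rw [if_neg fun h => hk (Subtype.ext h), mul_zero]
    · simp
  · refine Finset.sum_eq_zero fun k _ => ?_
    by_cases hk : (k : ℕ) = m
    · rw [hk, if_neg h]; simp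
    · rw [if_neg hk, mul_zero]

lemma bullet_segment_simple {i j : ℕ} (hi : 1 ≤ i) (hij : i ≤ j) (hj : j + 1 ≤ m + n - 1) :
    bullet (segment m n i j) (segment m n (j + 1) (j + 1)) = dot m j (j + 1) := by
  rw [segment_self (Finset.mem_Icc.2 ⟨by omega, hj⟩), bullet,
    Finset.sum_eq_single ⟨j, Finset.mem_Icc.2 ⟨by omega, by omega⟩⟩,
    Finset.sum_eq_single ⟨j + 1, Finset.mem_Icc.2 ⟨by omega, hj⟩⟩]
  · simp [simple_apply, segment, hij]
  · intro k _ hk; simp [simple_apply, Ne.symm hk]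
  · simp
  · intro k _ hk
    refine Finset.sum_eq_zero fun l _ => ?_
    rw [simple_apply]
    split_ifs with h
    · subst h
      simp only [segment]
      split_ifs with h
      · have : (k : ℕ) ≠ j := fun h => hk (Subtype.ext h)
        rw [dot, if_neg (by omega), if_neg (by omega), mul_zero]
      · simp
    · simp
  · simp

lemma dot_succ (m j : ℕ) : dot m j (j + 1) = if j < m then -1 else 1 := by
  rw [dot, if_neg (by omega), if_pos (.inl rfl)]
  congr 1
  simp only [eq_iff_iff]
  omega

/-- Appending `j + 1` adds `2 (j • (j + 1)) + (j + 1) • (j + 1)`, which is `0` except at `j + 1 =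
m`, where it is `-2`. -/
lemma bullet_segment_self {i j : ℕ} (hi : 1 ≤ i) (hij : i ≤ j) (hj : j ≤ m + n - 1) :
    bullet (segment m n i j) (segment m n i j) =
      if j < m then 2 else if m < i then -2 else 0 := by
  have hself (k : ℕ) (hk : k ∈ Finset.Icc 1 (m + n - 1)) :
      bullet (segment m n k k) (segment m n k k) = if k < m then 2 else if m < k then -2 else 0 := by
    rw [segment_self hk, bullet_simple_simple, dot, if_pos rfl]
  induction j, hij using Nat.le_induction with
  | base => exact hself i (Finset.mem_Icc.2 ⟨hi, hj⟩)
  | succ j hij ih =>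
    rw [segment_succ (by omega), bullet_add_left, bullet_add_right, bullet_add_right,
      bullet_comm (segment m n (j + 1) (j + 1)) (segment m n i j), bullet_segment_simple hi hij hj,
      ih (by omega), hself _ (Finset.mem_Icc.2 ⟨by omega, hj⟩), dot_succ]
    split_ifs <;> omega

lemma gen_eq_zero {k : ℕ} (h : k ∉ Finset.Icc 1 (m + n - 1)) : gen m n k = 0 := dif_neg h

lemma gen_eq {k : ℕ} (h : k ∈ Finset.Icc 1 (m + n - 1)) : gen m n k = θ ⟨k, h⟩ := dif_pos h

lemma rootVectorAux_zero_left (d : ℕ) : rootVectorAux m n 0 d = 0 := by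
  induction d with
  | zero => exact gen_eq_zero (by simp)
  | succ d ih => rw [rootVectorAux, ih]; simp

/-- The odd index `m` lies in at most one of two disjoint intervals, so the sign is trivial. -/
lemma sgn_mul_q_zpow_segment {i d : ℕ} (hi : 1 ≤ i) (hd : i + d + 1 ≤ m + n - 1) :
    sgn (parity (segment m n i (i + d)) * parity (segment m n (i + d + 1) (i + d + 1))) *
      q ^ bullet (segment m n i (i + d)) (segment m n (i + d + 1) (i + d + 1)) =
        braidCoeff m q (i + d + 1) := by
  rw [bullet_segment_simple hi (by omega) hd, parity_segment hi (by omega),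
    parity_segment (by omega) hd]
  have : (if i ≤ m ∧ m ≤ i + d then (1 : ZMod 2) else 0) *
      (if i + d + 1 ≤ m ∧ m ≤ i + d + 1 then 1 else 0) = 0 := by
    split_ifs <;> first | rfl | omega
  rw [this, sgn_zero, one_mul, dot_succ, braidCoeff]
  by_cases h : i + d + 1 ≤ m
  · rw [if_pos (by omega), if_pos h, zpow_neg_one]
  · rw [if_neg (by omega), if_neg h, zpow_one]

lemma rootVectorAux_succ (i d : ℕ) : rootVectorAux m n i (d + 1) =
    qBracket (braidCoeff m q (i + d + 1)) (rootVectorAux m n i d) (gen m n (i + d + 1)) := by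
  by_cases hk : i + d + 1 ∈ Finset.Icc 1 (m + n - 1)
  · rcases Nat.eq_zero_or_pos i with rfl | hi
    · simp [rootVectorAux_zero_left, qBracket]
    · rw [rootVectorAux, qBracket, sgn_mul_q_zpow_segment hi (Finset.mem_Icc.1 hk).2]
  · rw [rootVectorAux, qBracket, gen_eq_zero hk]; simp

/-! ### The images of the generators in the quotient by the Serre ideal -/

lemma q_pow_ne_one {k : ℕ} (hk : k ≠ 0) : q ^ k ≠ 1 := by
  intro h
  have h' : algebraMap (Polynomial ℚ) Kq (Polynomial.X ^ k) = algebraMap (Polynomial ℚ) Kq 1 := by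
    rw [map_pow, map_one]; simpa [q] using h
  have := congrArg Polynomial.natDegree (IsFractionRing.injective (Polynomial ℚ) Kq h')
  simp at this
  exact hk this

lemma q_add_inv_ne_zero : q + q⁻¹ ≠ 0 := by
  intro h
  have h1 : q ^ 2 = -1 := by
    have h2 : q * (q + q⁻¹) = 0 := by rw [h, mul_zero]
    rw [mul_add, mul_inv_cancel₀ q_ne_zero] at h2
    rw [pow_two]; exact eq_neg_of_add_eq_zero_left h2
  refine q_pow_ne_one (k := 4) (by norm_num) ?_
  rw [show q ^ 4 = (q ^ 2) ^ 2 by ring, h1]; norm_num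

section Quotient

variable {A : Type*} [Ring A] [Algebra Kq A]

/-- Indices outside `I` are sent to `0`, which makes the relations involving them trivial. -/
lemma serreSystem_of_relators (φ : FPrime m n →ₐ[Kq] A)
    (hφ : ∀ x, SerreRelator m n x → φ x = 0) : SerreSystem m q fun k => φ (gen m n k) where
  q_ne_zero := q_ne_zero
  q_add_inv_ne_zero := q_add_inv_ne_zero
  comm i j hij := by
    by_cases hi : i ∈ Finset.Icc 1 (m + n - 1)
    · by_cases hj : j ∈ Finset.Icc 1 (m + n - 1)
      · have := hφ _ (.comm ⟨i, hi⟩ ⟨j, hj⟩ (.inl hij))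
        rw [map_sub, map_mul, map_mul, sub_eq_zero] at this
        rwa [gen_eq hi, gen_eq hj]
      · simp [gen_eq_zero hj]
    · simp [gen_eq_zero hi]
  square := by
    by_cases hi : m ∈ Finset.Icc 1 (m + n - 1)
    · have := hφ _ (.square ⟨m, hi⟩ rfl)
      rwa [pow_two, map_mul, ← gen_eq hi] at this
    · simp [gen_eq_zero hi]
  cubic i j him hij := by
    by_cases hi : i ∈ Finset.Icc 1 (m + n - 1)
    · by_cases hj : j ∈ Finset.Icc 1 (m + n - 1)
      · have := hφ _ (.cubic ⟨i, hi⟩ ⟨j, hj⟩ him hij)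
        simp only [map_sub, map_add, map_mul, map_smul, pow_two, mul_assoc, sub_sub, sub_eq_zero] at this
        rwa [CubicRel, gen_eq hi, gen_eq hj]
      · simp [CubicRel, gen_eq_zero hj]
    · simp [CubicRel, gen_eq_zero hi]
  quartic k hk := by
    by_cases ha : k ∈ Finset.Icc 1 (m + n - 1)
    · by_cases hc : m + 1 ∈ Finset.Icc 1 (m + n - 1)
      · have hb : m ∈ Finset.Icc 1 (m + n - 1) := by
          rw [Finset.mem_Icc] at *; omega
        have := hφ _ (.quartic ⟨k, ha⟩ ⟨m, hb⟩ ⟨m + 1, hc⟩ hk rfl rfl)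
        simp only [map_sub, map_add, map_mul, map_smul, mul_assoc, sub_sub, sub_eq_zero] at this
        rw [gen_eq ha, gen_eq hb, gen_eq hc, this]
      · simp [gen_eq_zero hc]
    · simp [gen_eq_zero ha]

lemma map_rootVectorAux (φ : FPrime m n →ₐ[Kq] A) (i d : ℕ) :
    φ (rootVectorAux m n i d) = rootVecAux m q (fun k => φ (gen m n k)) i d := by
  induction d with
  | zero => rfl
  | succ d ih =>
    rw [rootVectorAux_succ, rootVecAux, ← ih, qBracket, qBracket, map_sub, map_smul, map_mul,
      map_mul]

end Quotient

/-! ### Positive roots as lexicographically ordered intervals -/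

namespace PosRoot

/-- The first index of a root. -/
abbrev fst (α : PosRoot m n) : ℕ := (ofLex α.1).1

/-- The last index of a root. -/
abbrev snd (α : PosRoot m n) : ℕ := (ofLex α.1).2

lemma fst_le_snd (α : PosRoot m n) : α.fst ≤ α.snd := α.2

lemma one_le_fst (α : PosRoot m n) : 1 ≤ α.fst := (Finset.mem_Icc.1 (ofLex α.1).1.2).1

lemma snd_le (α : PosRoot m n) : α.snd ≤ m + n - 1 := (Finset.mem_Icc.1 (ofLex α.1).2.2).2

lemma lt_iff (α β : PosRoot m n) :
    α < β ↔ α.fst < β.fst ∨ α.fst = β.fst ∧ α.snd < β.snd := by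
  rw [← Subtype.coe_lt_coe, Prod.Lex.lt_iff, Subtype.ext_iff]
  rfl

/-- The root `α_i + ⋯ + α_j`. -/
def mk (i j : ℕ) (hi : 1 ≤ i) (hij : i ≤ j) (hj : j ≤ m + n - 1) : PosRoot m n :=
  ⟨toLex (⟨i, Finset.mem_Icc.2 ⟨hi, hij.trans hj⟩⟩, ⟨j, Finset.mem_Icc.2 ⟨hi.trans hij, hj⟩⟩), hij⟩

lemma fst_mk {i j : ℕ} (hi : 1 ≤ i) (hij : i ≤ j) (hj : j ≤ m + n - 1) :
    (mk i j hi hij hj).fst = i := rfl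

lemma snd_mk {i j : ℕ} (hi : 1 ≤ i) (hij : i ≤ j) (hj : j ≤ m + n - 1) :
    (mk i j hi hij hj).snd = j := rfl

lemma parity_eq (α : PosRoot m n) :
    α.parity = if α.fst ≤ m ∧ m ≤ α.snd then 1 else 0 :=
  parity_segment α.one_le_fst α.snd_le

end PosRoot

lemma map_rootVector {A : Type*} [Ring A] [Algebra Kq A] (φ : FPrime m n →ₐ[Kq] A)
    (α : PosRoot m n) :
    φ (rootVector α) = rootVec m q (fun k => φ (gen m n k)) α.fst α.snd :=
  map_rootVectorAux φ _ _

/-! ### Spanning -/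

section Spanning

variable {A : Type*} [Ring A] [Algebra Kq A]

/-- The elements of a subalgebra `U` which can be moved to the right of `b` modulo `U`. -/
def moveSubalgebra (U : Subalgebra Kq A) (b : A) : Subalgebra Kq A where
  carrier := {u | u ∈ U ∧ ∃ x ∈ U, ∃ y ∈ U, u * b = b * x + y}
  mul_mem' := by
    rintro u v ⟨hu, x, hx, y, hy, h⟩ ⟨hv, x', hx', y', hy', h'⟩
    refine ⟨mul_mem hu hv, x * x', mul_mem hx hx', y * x' + u * y',
      add_mem (mul_mem hy hx') (mul_mem hu hy'), ?_⟩
    rw [mul_assoc, h', mul_add, ← mul_assoc, h, add_mul, mul_assoc, add_assoc]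
  add_mem' := by
    rintro u v ⟨hu, x, hx, y, hy, h⟩ ⟨hv, x', hx', y', hy', h'⟩
    refine ⟨add_mem hu hv, x + x', add_mem hx hx', y + y', add_mem hy hy', ?_⟩
    rw [add_mul, h, h', mul_add]; abel
  algebraMap_mem' r := ⟨U.algebraMap_mem r, _, U.algebraMap_mem r, 0, zero_mem U, by
    rw [add_zero, Algebra.commutes]⟩

lemma QCommute.mem_moveSubalgebra {U : Subalgebra Kq A} {b u : A} {ξ : Kq} (h : QCommute ξ u b)
    (hu : u ∈ U) : u ∈ moveSubalgebra U b :=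
  ⟨hu, ξ • u, U.smul_mem hu ξ, 0, zero_mem U, by rw [h, mul_smul_comm, add_zero]⟩

lemma adjoin_le_of_mul_mem {X : Set A} {W : Submodule Kq A} (h1 : (1 : A) ∈ W)
    (h : ∀ w ∈ W, ∀ x ∈ X, w * x ∈ W) {u : A} (hu : u ∈ Algebra.adjoin Kq X) : u ∈ W := by
  suffices h' : ∀ w ∈ W, w * u ∈ W by simpa using h' 1 h1
  induction hu using Algebra.adjoin_induction with
  | mem x hx => exact fun w hw => h w hw x hx
  | algebraMap r =>
    intro w hw
    rw [← Algebra.commutes, ← Algebra.smul_def]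
    exact W.smul_mem r hw
  | add x y _ _ hx hy => intro w hw; rw [mul_add]; exact add_mem (hx w hw) (hy w hw)
  | mul x y _ _ hx hy => intro w hw; rw [← mul_assoc]; exact hy _ (hx w hw)

variable (φ : FPrime m n →ₐ[Kq] A)

/-- The span of the ordered monomials in the root vectors of the list `L`. -/
def listSpan (L : List (PosRoot m n)) : Submodule Kq A :=
  Submodule.span Kq (Set.range fun e : PBWExponent m n =>
    (L.map fun α => φ (rootVector α) ^ e.1 α).prod)

variable {φ}

/-- No bound on `k` is needed: at an odd root any power beyond the first vanishes. -/
lemma pow_mul_mem_listSpan (H : SerreSystem m q fun k => φ (gen m n k)) {β : PosRoot m n}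
    {L : List (PosRoot m n)} (hβ : β ∉ L) (k : ℕ) {u : A} (hu : u ∈ listSpan φ L) :
    φ (rootVector β) ^ k * u ∈ listSpan φ (β :: L) := by
  classical
  by_cases hk : β.parity = 1 ∧ 2 ≤ k
  · have hβ' : β.fst ≤ m ∧ m ≤ β.snd := by
      have := hk.1
      rw [β.parity_eq] at this
      by_contra h
      rw [if_neg h] at this
      exact zero_ne_one this
    obtain ⟨l, rfl⟩ := Nat.exists_eq_add_of_le hk.2
    rw [pow_add, pow_two, map_rootVector, H.rootVec_mul_self hβ'.1 hβ'.2, zero_mul, zero_mul]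
    exact zero_mem _
  · induction hu using Submodule.span_induction with
    | zero => simp
    | add x y _ _ hx hy => rw [mul_add]; exact add_mem hx hy
    | smul r x _ hx => rw [mul_smul_comm]; exact Submodule.smul_mem _ _ hx
    | mem x hx =>
      obtain ⟨e, rfl⟩ := hx
      refine Submodule.subset_span ⟨⟨Function.update e.1 β k, fun α hα => ?_⟩, ?_⟩
      · by_cases h : α = β
        · subst h
          rw [Function.update_self]
          by_contra h'
          exact hk ⟨hα, by omega⟩
        · rw [Function.update_of_ne h]; exact e.2 α hα
      · simp only [List.map_cons, List.prod_cons, Function.update_self]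
        congr 2
        refine List.map_congr_left fun α hα => ?_
        rw [Function.update_of_ne]
        rintro rfl
        exact hβ hα

/-- A root vector starting after `β.fst` is a polynomial in letters beyond `β.fst`, so only letters
have to be moved past `θ_β`: inside `β`, at its end, just after it, or far away. Root vectors with
the same first index commute with `θ_β` up to a scalar. -/
lemma moveSubalgebra_rootVector (H : SerreSystem m q fun k => φ (gen m n k)) {β : PosRoot m n}
    {U : Subalgebra Kq A} (hU : ∀ γ, β < γ → φ (rootVector γ) ∈ U) {γ : PosRoot m n}
    (hγ : β < γ) : φ (rootVector γ) ∈ moveSubalgebra U (φ (rootVector β)) := by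
  have hgen (k : ℕ) (hk : β.fst < k) :
      φ (gen m n k) ∈ moveSubalgebra U (φ (rootVector β)) := by
    by_cases hk' : k ∈ Finset.Icc 1 (m + n - 1)
    swap
    · rw [gen_eq_zero hk', map_zero]; exact zero_mem _
    have hkN := (Finset.mem_Icc.1 hk').2
    have hkU : φ (gen m n k) ∈ U := by
      have h := hU (PosRoot.mk k k (by omega) le_rfl hkN) ((PosRoot.lt_iff _ _).2 (.inl hk))
      rwa [map_rootVector, PosRoot.fst_mk, PosRoot.snd_mk, rootVec_self] at h
    rw [map_rootVector]
    rcases lt_trichotomy k β.snd with h | h | h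
    · exact (H.rootVec_middle hk h).mem_moveSubalgebra hkU
    · obtain ⟨j, hj⟩ : ∃ j, β.snd = j + 1 := ⟨β.snd - 1, by omega⟩
      obtain ⟨ξ, hξ, h'⟩ := H.rootVec_last (s := β.fst) (k := j) (by omega)
      rw [h, hj]
      rw [h, hj] at hkU
      exact (h'.symm hξ).mem_moveSubalgebra hkU
    · rcases (Nat.succ_le_of_lt h).eq_or_lt with h | h
      · rw [Nat.succ_eq_add_one] at h
        subst h
        have hc := H.braidCoeff_ne_zero (β.snd + 1)
        have hE := hU (PosRoot.mk β.fst (β.snd + 1) β.one_le_fst (by have := β.fst_le_snd; omega)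
          hkN) ((PosRoot.lt_iff _ _).2 (.inr ⟨rfl, Nat.lt_succ_self _⟩))
        rw [map_rootVector] at hE
        replace hE : rootVec m q (fun k => φ (gen m n k)) β.fst (β.snd + 1) ∈ U := hE
        -- The definition of the next root vector `E' = E g - c g E` in the row, solved for `g E =
        -- c⁻¹ E g - c⁻¹ E'`.
        refine ⟨hkU, _, U.smul_mem hkU (braidCoeff m q (β.snd + 1))⁻¹, _,
          U.smul_mem hE (-(braidCoeff m q (β.snd + 1))⁻¹), ?_⟩
        rw [rootVec_succ β.fst_le_snd, qBracket, smul_sub, mul_smul_comm, smul_smul, neg_mul,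
          inv_mul_cancel₀ hc, neg_smul, neg_smul, one_smul]
        abel
      · have h' := (H.rootVec_far β.fst_le_snd h).symm one_ne_zero
        exact h'.mem_moveSubalgebra hkU
  rcases (PosRoot.lt_iff _ _).1 hγ with h | ⟨h, h'⟩
  · rw [map_rootVector φ γ]
    have hle := γ.fst_le_snd
    generalize γ.snd = l at hle
    induction l, hle using Nat.le_induction with
    | base => rw [rootVec_self]; exact hgen _ h
    | succ l hl ih =>
      rw [rootVec_succ hl, qBracket]
      have hg := hgen (l + 1) (by omega)
      exact sub_mem (mul_mem ih hg) (Subalgebra.smul_mem _ (mul_mem hg ih) _)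
  · obtain ⟨ξ, hξ, hc⟩ := H.rootVec_row β.fst_le_snd h'
    have hc' := hc.symm hξ
    rw [h, ← map_rootVector, ← h, ← map_rootVector] at hc'
    exact hc'.mem_moveSubalgebra (hU γ hγ)

/-- Let `U` be generated by the tail. The span `W` of the `θ_β^k U` is stable under right
multiplication by `θ_β`, because `U θ_β ⊆ θ_β U + U`, and by the tail trivially. Closure of the list
under larger roots ensures that the root vectors arising in straightening belong to `U`. -/
lemma adjoin_rootVector_le (H : SerreSystem m q fun k => φ (gen m n k))
    {L : List (PosRoot m n)} (hL : L.Pairwise (· < ·)) (hup : ∀ γ ∈ L, ∀ δ, γ ≤ δ → δ ∈ L) {u : A}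
    (hu : u ∈ Algebra.adjoin Kq ((fun γ => φ (rootVector γ)) '' {γ | γ ∈ L})) :
    u ∈ listSpan φ L := by
  induction L generalizing u with
  | nil =>
    have h1 : (1 : A) ∈ listSpan φ [] := Submodule.subset_span ⟨⟨0, by simp⟩, by simp⟩
    refine adjoin_le_of_mul_mem h1 ?_ hu
    rintro w - x ⟨γ, hγ, -⟩
    simp at hγ
  | cons β L ih =>
    rw [List.pairwise_cons] at hL
    have hβ : β ∉ L := fun h => (hL.1 β h).false
    have hLβ (γ : PosRoot m n) (h : β < γ) : γ ∈ L :=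
      (List.mem_cons.1 (hup β (by simp) γ h.le)).resolve_left h.ne'
    have hup' : ∀ γ ∈ L, ∀ δ, γ ≤ δ → δ ∈ L := fun γ hγ δ hδ => hLβ δ ((hL.1 γ hγ).trans_le hδ)
    set U := Algebra.adjoin Kq ((fun γ => φ (rootVector γ)) '' {γ | γ ∈ L}) with hUdef
    have hU (γ) (h : β < γ) : φ (rootVector γ) ∈ U :=
      Algebra.subset_adjoin ⟨γ, hLβ γ h, rfl⟩
    have hmove : U ≤ moveSubalgebra U (φ (rootVector β)) := by
      refine Algebra.adjoin_le ?_
      rintro _ ⟨γ, hγ, rfl⟩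
      exact moveSubalgebra_rootVector H hU (hL.1 γ hγ)
    let W : Submodule Kq A := Submodule.span Kq
      {x | ∃ k : ℕ, ∃ u ∈ U, x = φ (rootVector β) ^ k * u}
    have hW : u ∈ W := by
      have h1 : (1 : A) ∈ W := Submodule.subset_span ⟨0, 1, one_mem U, by simp⟩
      refine adjoin_le_of_mul_mem h1 ?_ hu
      rintro w hw _ ⟨γ, hγ, rfl⟩
      induction hw using Submodule.span_induction with
      | zero => simp
      | add x y _ _ hx hy => rw [add_mul]; exact add_mem hx hy
      | smul r x _ hx => rw [smul_mul_assoc]; exact Submodule.smul_mem _ _ hx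
      | mem x hx =>
        obtain ⟨k, v, hv, rfl⟩ := hx
        rcases List.mem_cons.1 hγ with rfl | hγ
        · obtain ⟨-, x, hx, y, hy, h⟩ := hmove hv
          simp only [mul_assoc, h, mul_add]
          rw [← mul_assoc, ← pow_succ]
          exact add_mem (Submodule.subset_span ⟨_, _, hx, rfl⟩)
            (Submodule.subset_span ⟨_, _, hy, rfl⟩)
        · rw [mul_assoc]
          exact Submodule.subset_span ⟨_, _, mul_mem hv (hU γ (hL.1 γ hγ)), rfl⟩
    refine Submodule.span_le.2 ?_ hW
    rintro _ ⟨k, u, hu, rfl⟩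
    exact pow_mul_mem_listSpan H hβ k (ih hL.2 hup' hu)

end Spanning

lemma exists_sub_mem_serreIdeal (x : FPrime m n) :
    ∃ y ∈ Submodule.span Kq (Set.range fun e : PBWExponent m n => pbwMonomial e.1),
      x - y ∈ serreIdeal m n := by
  let φ : FPrime m n →ₐ[Kq] (serreIdeal m n).ringCon.Quotient := (serreIdeal m n).ringCon.mkₐ Kq
  have hφ (x y : FPrime m n) : φ x = φ y ↔ x - y ∈ serreIdeal m n := by
    rw [← TwoSidedIdeal.rel_iff]
    exact (serreIdeal m n).ringCon.eq
  have H : SerreSystem m q fun k => φ (gen m n k) := by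
    refine serreSystem_of_relators φ fun x hx => ?_
    rw [← map_zero φ, hφ, sub_zero]
    exact TwoSidedIdeal.subset_span hx
  have hx : φ x ∈ listSpan φ ((Finset.univ : Finset (PosRoot m n)).sort (· ≤ ·)) := by
    refine adjoin_rootVector_le H (Finset.sortedLT_sort _).pairwise (fun _ _ _ _ => by simp) ?_
    induction x using FPrime.induction_left with
    | one => rw [map_one]; exact one_mem _
    | mul i x ih =>
      rw [map_mul]
      refine mul_mem (Algebra.subset_adjoin ?_) ih
      have hi := Finset.mem_Icc.1 i.2
      refine ⟨PosRoot.mk i i hi.1 le_rfl hi.2, by simp, ?_⟩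
      simp only [map_rootVector, PosRoot.fst_mk, PosRoot.snd_mk, rootVec_self]
      rw [gen_eq i.2]
    | add x y hx hy => rw [map_add]; exact add_mem hx hy
    | smul r x hx => rw [map_smul]; exact Subalgebra.smul_mem _ hx r
  have hmap : listSpan φ ((Finset.univ : Finset (PosRoot m n)).sort (· ≤ ·)) =
      (Submodule.span Kq (Set.range fun e : PBWExponent m n => pbwMonomial e.1)).map
        φ.toLinearMap := by
    rw [Submodule.map_span, ← Set.range_comp, listSpan]
    congr 2
    funext e
    simp [pbwMonomial, map_list_prod, Function.comp_def]
  rw [hmap] at hx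
  obtain ⟨y, hy, h⟩ := hx
  exact ⟨y, hy, (hφ _ _).1 h.symm⟩

/-! ### Orthogonality of the PBW monomials -/

/-- The span of the `u ⊗ v` with `u` homogeneous of a weight in `S`. -/
def firstWeight (S : Set (Idx m n → ℕ)) : Submodule Kq (TwistedSquare m n) :=
  Submodule.span Kq {t | ∃ μ ∈ S, ∃ u ∈ weightSpace μ, ∃ w, t = tens u (monomial w)}

lemma tens_mem_firstWeight {S : Set (Idx m n → ℕ)} {μ : Idx m n → ℕ} (hμ : μ ∈ S)
    {u : FPrime m n} (hu : u ∈ weightSpace μ) (v : FPrime m n) : tens u v ∈ firstWeight S := by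
  have hv : v ∈ Submodule.span Kq (Set.range (monomial (m := m) (n := n))) := by
    rw [span_range_monomial]; trivial
  induction hv using Submodule.span_induction with
  | mem x hx =>
    obtain ⟨w, rfl⟩ := hx
    exact Submodule.subset_span ⟨μ, hμ, u, hu, w, rfl⟩
  | zero => rw [tens_zero_right]; exact zero_mem _
  | add x y _ _ hx hy => rw [tens_add_right]; exact add_mem hx hy
  | smul r x _ hx => rw [tens_smul_right]; exact Submodule.smul_mem _ _ hx

lemma firstWeight_mono {S S' : Set (Idx m n → ℕ)} (h : S ⊆ S') :
    firstWeight S ≤ firstWeight S' :=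
  Submodule.span_mono fun _ ⟨μ, hμ, ht⟩ => ⟨μ, h hμ, ht⟩

lemma mul_mem_firstWeight {S S' S'' : Set (Idx m n → ℕ)}
    (h : ∀ μ ∈ S, ∀ ν ∈ S', μ + ν ∈ S'') {t t' : TwistedSquare m n} (ht : t ∈ firstWeight S)
    (ht' : t' ∈ firstWeight S') : t * t' ∈ firstWeight S'' := by
  induction ht using Submodule.span_induction with
  | zero => rw [zero_mul]; exact zero_mem _
  | add x y _ _ hx hy => rw [add_mul]; exact add_mem hx hy
  | smul r x _ hx => rw [smul_mul_assoc]; exact Submodule.smul_mem _ _ hx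
  | mem t ht =>
    obtain ⟨μ, hμ, u, hu, w, rfl⟩ := ht
    induction ht' using Submodule.span_induction with
    | zero => rw [mul_zero]; exact zero_mem _
    | add x y _ _ hx hy => rw [mul_add]; exact add_mem hx hy
    | smul r x _ hx => rw [mul_smul_comm]; exact Submodule.smul_mem _ _ hx
    | mem t' ht' =>
      obtain ⟨ν, hν, u', hu', w', rfl⟩ := ht'
      rw [tens_mul_tens' (monomial_mem w) hu']
      exact Submodule.smul_mem _ _
        (tens_mem_firstWeight (h μ hμ ν hν) (mul_mem_weightSpace hu hu') _)

lemma squareForm_eq_zero_of_firstWeight {S : Set (Idx m n → ℕ)} {μ : Idx m n → ℕ} (hμ : μ ∉ S)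
    {u : FPrime m n} (hu : u ∈ weightSpace μ) (v : FPrime m n) {t : TwistedSquare m n}
    (ht : t ∈ firstWeight S) : squareForm (form m n) (tens u v) t = 0 := by
  induction ht using Submodule.span_induction with
  | zero => simp
  | add x y _ _ hx hy => rw [map_add, hx, hy, add_zero]
  | smul r x _ hx => rw [map_smul, hx, smul_zero]
  | mem t ht =>
    obtain ⟨ν, hν, u', hu', w, rfl⟩ := ht
    rw [squareForm_tens, form_eq_zero (fun h => hμ (by rwa [h])) hu hu', zero_mul]

lemma squareForm_form_comm (t t' : TwistedSquare m n) :
    squareForm (form m n) t t' = squareForm (form m n) t' t := by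
  have h : (form m n).flip = form m n := LinearMap.ext₂ fun x y => form_comm y x
  have h' := squareForm_flip (form m n)
  rw [h] at h'
  exact LinearMap.congr_fun₂ h' t t'

/-- The nonzero weights supported on the indices greater than `i`. -/
def weightsAbove (m n i : ℕ) : Set (Idx m n → ℕ) :=
  {μ | μ ≠ 0 ∧ ∀ k : Idx m n, (k : ℕ) ≤ i → μ k = 0}

lemma sgn_mul_q_zpow_mul_twist (μ ν : Idx m n → ℕ) :
    sgn (parity μ * parity ν) * q ^ bullet μ ν * twist ν μ = 1 := by
  have h : ∀ a : ZMod 2, a + a = 0 := by decide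
  have h' : sgn (parity μ * parity ν) * sgn (parity μ * parity ν) = 1 := by
    rw [← sgn_add, h, sgn_zero]
  rw [twist, bullet_comm ν, mul_comm (parity ν), zpow_neg]
  have hq := zpow_ne_zero (bullet μ ν) q_ne_zero
  rw [mul_comm (q ^ _)⁻¹, mul_mul_mul_comm, h', one_mul, mul_inv_cancel₀ hq]

lemma Δ_gen (k : ℕ) : Δ m n (gen m n k) = tens (gen m n k) 1 + tens 1 (gen m n k) := by
  unfold gen
  split_ifs
  · exact Δ_theta _
  · rw [map_zero, tens_zero_left, tens_zero_right, add_zero]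

lemma segment_apply_of_lt {i j : ℕ} {k : Idx m n} (h : (k : ℕ) < i) : segment m n i j k = 0 :=
  if_neg (by omega)

lemma segment_ne_zero {i j : ℕ} (hi : 1 ≤ i) (hij : i ≤ j) (hj : j ≤ m + n - 1) :
    segment m n i j ≠ 0 := by
  intro h
  have := congrFun h ⟨i, Finset.mem_Icc.2 ⟨hi, by omega⟩⟩
  simp [segment, hij] at this

lemma braidCoeff_mul_twist {i d : ℕ} (hi : 1 ≤ i) (hd : i + d + 1 ≤ m + n - 1) :
    braidCoeff m q (i + d + 1) *
      twist (segment m n (i + d + 1) (i + d + 1)) (segment m n i (i + d)) = 1 := by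
  rw [← sgn_mul_q_zpow_segment hi hd, sgn_mul_q_zpow_mul_twist]

/-- The scalar `c` is the one that cancels `x ⊗ y`; among the cross terms of the primitive parts
only `y ⊗ x` is left. -/
lemma Δ_qBracket {μ ν : Idx m n → ℕ} {x y : FPrime m n} (hx : x ∈ weightSpace μ)
    (hy : y ∈ weightSpace ν) (hΔ : Δ m n y = tens y 1 + tens 1 y) {c : Kq}
    (hc : c * twist ν μ = 1) :
    Δ m n (qBracket c x y) - tens (qBracket c x y) 1 - tens 1 (qBracket c x y) =
      (twist μ ν - c) • tens y x + (Δ m n x - tens x 1 - tens 1 x) * Δ m n y -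
        c • (Δ m n y * (Δ m n x - tens x 1 - tens 1 x)) := by
  have e1 : tens 1 x * tens y 1 = _ := one_tens_mul_tens hx hy 1
  have e2 : tens 1 y * tens x 1 = _ := one_tens_mul_tens hy hx 1
  rw [mul_one] at e1 e2
  have e3 : c • (twist ν μ • tens x y) = tens x y := by rw [smul_smul, hc, one_smul]
  have e4 : (tens x 1 + tens 1 x) * Δ m n y =
      tens (x * y) 1 + tens x y + twist μ ν • tens y x + tens 1 (x * y) := by
    rw [hΔ, add_mul, mul_add, mul_add, tens_one_mul_tens, tens_one_mul_tens, e1,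
      tens_mul_one_tens, mul_one]
    abel
  have e5 : Δ m n y * (tens x 1 + tens 1 x) =
      tens (y * x) 1 + tens y x + twist ν μ • tens x y + tens 1 (y * x) := by
    rw [hΔ, add_mul, mul_add, mul_add, tens_one_mul_tens, tens_one_mul_tens, e2,
      tens_mul_one_tens, mul_one]
    abel
  rw [sub_sub (Δ m n x), sub_mul, mul_sub, e4, e5, qBracket, map_sub, map_smul, map_mul, map_mul,
    sub_eq_add_neg (x * y), ← neg_smul, tens_add_left, tens_smul_left, tens_add_right,
    tens_smul_right, neg_smul, neg_smul]
  simp only [smul_add, smul_sub, e3, sub_smul]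
  abel

lemma add_mem_weightsAbove {i : ℕ} {μ ν : Idx m n → ℕ} (hμ : μ ∈ weightsAbove m n i)
    (hν : ν ∈ weightsAbove m n i ∪ {0}) : μ + ν ∈ weightsAbove m n i := by
  refine ⟨fun h => hμ.1 (funext fun k => ?_), fun k hk => ?_⟩
  · have := congrFun h k
    simp only [Pi.add_apply, Pi.zero_apply] at this ⊢
    omega
  · rcases hν with hν | rfl
    · simp [hμ.2 k hk, hν.2 k hk]
    · simp [hμ.2 k hk]

/-- Each bracket with a letter `j > i` adds only terms whose first factor contains `j` or comes from
the earlier defect, so the letter `i` never enters the first factor. -/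
lemma Δ_rootVectorAux {i d : ℕ} (hi : 1 ≤ i) (hd : i + d ≤ m + n - 1) :
    Δ m n (rootVectorAux m n i d) - tens (rootVectorAux m n i d) 1 -
      tens 1 (rootVectorAux m n i d) ∈ firstWeight (weightsAbove m n i) := by
  induction d with
  | zero =>
    rw [rootVectorAux, Δ_gen, add_sub_cancel_left, sub_self]
    exact zero_mem _
  | succ d ih =>
    have hg := gen_mem (m := m) (n := n) (i + d + 1)
    have hg1 : segment m n (i + d + 1) (i + d + 1) ∈ weightsAbove m n i :=
      ⟨segment_ne_zero (by omega) le_rfl hd, fun k hk => segment_apply_of_lt (by omega)⟩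
    have hΔg : Δ m n (gen m n (i + d + 1)) ∈ firstWeight (weightsAbove m n i ∪ {0}) := by
      rw [Δ_gen]
      exact add_mem (tens_mem_firstWeight (.inl hg1) hg _)
        (tens_mem_firstWeight (.inr rfl) one_mem_weightSpace _)
    rw [rootVectorAux_succ, Δ_qBracket (rootVectorAux_mem i d) hg (Δ_gen _)
      (braidCoeff_mul_twist hi hd)]
    refine sub_mem (add_mem (Submodule.smul_mem _ _ (tens_mem_firstWeight hg1 hg _)) ?_)
      (Submodule.smul_mem _ _ ?_)
    · exact mul_mem_firstWeight (fun μ hμ ν hν => add_mem_weightsAbove hμ hν) (ih (by omega)) hΔg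
    · exact mul_mem_firstWeight (fun μ hμ ν hν => add_comm ν μ ▸ add_mem_weightsAbove hν hμ) hΔg
        (ih (by omega))

/-- The weight of a positive root. -/
def PosRoot.toWeight (α : PosRoot m n) : Idx m n → ℕ := segment m n α.fst α.snd

lemma rootVector_mem (α : PosRoot m n) : rootVector α ∈ weightSpace α.toWeight := by
  have h := rootVectorAux_mem (m := m) (n := n) α.fst (α.snd - α.fst)
  rwa [Nat.add_sub_cancel' α.fst_le_snd] at h

lemma PosRoot.toWeight_ne_zero (α : PosRoot m n) : α.toWeight ≠ 0 :=
  segment_ne_zero α.one_le_fst α.fst_le_snd α.snd_le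

lemma Δ_rootVector (α : PosRoot m n) :
    Δ m n (rootVector α) - tens (rootVector α) 1 - tens 1 (rootVector α) ∈
      firstWeight (weightsAbove m n α.fst) :=
  Δ_rootVectorAux α.one_le_fst (by
    rw [Nat.add_sub_cancel' α.fst_le_snd]; exact α.snd_le)

/-! ### Peeling the smallest root vector off a pairing -/

/-- The nonzero weights which either vanish at the first index of `β`, or are not bounded by `β`. -/
def badWeights (β : PosRoot m n) : Set (Idx m n → ℕ) :=
  {μ | μ ≠ 0 ∧ (μ (ofLex β.1).1 = 0 ∨ ¬ μ ≤ β.toWeight)}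

/-- A weight not bounded by `β` stays so after any addition. Vanishing at the first index is lost
only by adding `β` or an unbounded weight, and the sum then exceeds `β` somewhere because `μ ≠ 0`.
-/
lemma add_mem_badWeights {β : PosRoot m n} {μ ν : Idx m n → ℕ} (hμ : μ ∈ badWeights β)
    (hν : ν ∈ badWeights β ∪ {0, β.toWeight}) : μ + ν ∈ badWeights β := by
  have hne : μ + ν ≠ 0 := fun h => hμ.1 (funext fun k => by
    have := congrFun h k
    simp only [Pi.add_apply, Pi.zero_apply] at this ⊢
    omega)
  refine ⟨hne, ?_⟩
  rcases hμ.2 with h | h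
  swap
  · exact .inr fun h' => h (le_trans (fun k => Nat.le_add_right _ _) h')
  rcases hν with hν | rfl | rfl
  · rcases hν.2 with h' | h'
    · left; simp [h, h']
    · exact .inr fun h'' => h' (le_trans (fun k => Nat.le_add_left _ _) h'')
  · left; simpa using h
  · refine .inr fun h' => hμ.1 (funext fun k => ?_)
    have := h' k
    simp only [Pi.add_apply, Pi.zero_apply] at this ⊢
    omega

lemma weightsAbove_subset_badWeights {β : PosRoot m n} {i : ℕ} (hi : β.fst ≤ i) :
    weightsAbove m n i ⊆ badWeights β := fun _ hμ => ⟨hμ.1, .inl (hμ.2 _ hi)⟩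

lemma toWeight_notMem_badWeights (β : PosRoot m n) : β.toWeight ∉ badWeights β := by
  rintro ⟨-, h | h⟩
  · have h1 : β.fst ≤ β.snd := β.fst_le_snd
    rw [PosRoot.toWeight, segment, if_pos ⟨le_rfl, h1⟩] at h
    exact one_ne_zero h
  · exact h le_rfl

/-- The elements with `Δ(x) ≡ 1 ⊗ x` modulo terms whose first factor has a bad weight. -/
def almostPrimitive (β : PosRoot m n) : Submonoid (FPrime m n) where
  carrier := {x | Δ m n x - tens 1 x ∈ firstWeight (badWeights β)}
  one_mem' := by
    change Δ m n 1 - tens 1 1 ∈ firstWeight (badWeights β)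
    rw [map_one, one_eq_tens, sub_self]; exact zero_mem _
  mul_mem' {x y} hx hy := by
    change Δ m n (x * y) - tens 1 (x * y) ∈ firstWeight (badWeights β)
    have hx' : Δ m n x - tens 1 x ∈ firstWeight (badWeights β) := hx
    have hy' : Δ m n y - tens 1 y ∈ firstWeight (badWeights β) := hy
    have e : Δ m n (x * y) - tens 1 (x * y) = (Δ m n x - tens 1 x) * (Δ m n y - tens 1 y) +
        (Δ m n x - tens 1 x) * tens 1 y + tens 1 x * (Δ m n y - tens 1 y) := by
      rw [map_mul, ← tens_mul_one_tens]; noncomm_ring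
    have h0 (z : FPrime m n) : tens 1 z ∈ firstWeight {0} :=
      tens_mem_firstWeight (Set.mem_singleton 0) one_mem_weightSpace z
    rw [e]
    refine add_mem (add_mem (mul_mem_firstWeight ?_ hx' hy') (mul_mem_firstWeight ?_ hx' (h0 y)))
      (mul_mem_firstWeight ?_ (h0 x) hy')
    · exact fun μ hμ ν hν => add_mem_badWeights hμ (.inl hν)
    · rintro μ hμ _ rfl; simpa using hμ
    · rintro _ rfl μ hμ; simpa using hμ

lemma mem_almostPrimitive {β : PosRoot m n} {x : FPrime m n} :
    x ∈ almostPrimitive β ↔ Δ m n x - tens 1 x ∈ firstWeight (badWeights β) := Iff.rfl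

/-- Here the lexicographic order enters: a later root either starts after `β`, hence vanishes at the
first index of `β`, or has the same start and is longer, hence is not bounded by `β`. -/
lemma rootVector_mem_almostPrimitive {β γ : PosRoot m n} (h : β < γ) :
    rootVector γ ∈ almostPrimitive β := by
  rw [PosRoot.lt_iff] at h
  have h1 := firstWeight_mono (weightsAbove_subset_badWeights (β := β) (by omega))
    (Δ_rootVector γ)
  have h2 : γ.toWeight ∈ badWeights β := by
    refine ⟨γ.toWeight_ne_zero, ?_⟩
    rcases h with h | ⟨h, h'⟩
    · exact .inl (segment_apply_of_lt h)
    · right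
      intro hle
      have hle := hle (ofLex γ.1).2
      have hγ := γ.fst_le_snd
      simp only [PosRoot.toWeight, segment] at hle
      rw [if_pos ⟨hγ, le_rfl⟩, if_neg (by simp only [not_and, not_le]; exact fun _ => h')] at hle
      omega
  have h3 := add_mem h1 (tens_mem_firstWeight h2 (rootVector_mem γ) 1)
  rw [mem_almostPrimitive]
  convert h3 using 1
  abel

/-- The scalars `1 + t + ⋯ + t^{k-1}` with `(x ⊗ x)(x ⊗ x) = t x² ⊗ x²` for `x` of weight `β`. -/
def quantumInt (β : PosRoot m n) (k : ℕ) : Kq :=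
  ∑ t ∈ Finset.range k, twist β.toWeight β.toWeight ^ t

/-- Moving `1 ⊗ θ_β` past `θ_β ⊗ 1` costs `t = twist β β`, whence the recursion `[k + 1] = 1 + t
[k]`. The terms in `θ_β² ⊗ _` have first weight `2β`, which is bad. -/
lemma Δ_rootVector_pow_mul (β : PosRoot m n) (k : ℕ) {y : FPrime m n}
    (hy : y ∈ almostPrimitive β) :
    Δ m n (rootVector β ^ k * y) - tens 1 (rootVector β ^ k * y) -
      quantumInt β k • tens (rootVector β) (rootVector β ^ (k - 1) * y) ∈
        firstWeight (badWeights β) := by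
  induction k with
  | zero => simpa [quantumInt] using mem_almostPrimitive.1 hy
  | succ k ih =>
    have hE := rootVector_mem β
    have hΔ := firstWeight_mono (weightsAbove_subset_badWeights (β := β) le_rfl) (Δ_rootVector β)
    have hEE : β.toWeight + β.toWeight ∈ badWeights β := by
      have hne := β.toWeight_ne_zero
      refine ⟨fun h => hne (funext fun k => ?_), .inr fun h => hne (funext fun k => ?_)⟩
      · have := congrFun h k
        simp only [Pi.add_apply, Pi.zero_apply] at this ⊢
        omega
      · have := h k
        simp only [Pi.add_apply, Pi.zero_apply] at this ⊢
        omega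
    have hq : quantumInt β (k + 1) = 1 + twist β.toWeight β.toWeight * quantumInt β k := by
      simp only [quantumInt, Finset.sum_range_succ', Finset.mul_sum, pow_succ', pow_zero, add_comm]
    -- The truncated exponent `k - 1` is harmless at `k = 0`, where `quantumInt` vanishes.
    have hpow : quantumInt β k • (tens (rootVector β) (rootVector β * (rootVector β ^ (k - 1) * y)))
        = quantumInt β k • tens (rootVector β) (rootVector β ^ k * y) := by
      cases k with
      | zero => simp [quantumInt]
      | succ k => rw [Nat.add_sub_cancel, ← mul_assoc, ← pow_succ']
    set E := rootVector β
    set z := E ^ k * y with hz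
    set z' := E ^ (k - 1) * y
    set R := Δ m n E - tens E 1 - tens 1 E with hR
    set T := Δ m n z - tens 1 z - quantumInt β k • tens E z' with hT
    have hR' : Δ m n E = tens E 1 + tens 1 E + R := by rw [hR]; abel
    have hT' : Δ m n z = tens 1 z + quantumInt β k • tens E z' + T := by rw [hT]; abel
    have e1 : E ^ (k + 1) * y = E * z := by rw [hz, pow_succ', mul_assoc]
    rw [e1, Nat.add_sub_cancel, map_mul]
    have m0 (x : FPrime m n) : tens 1 x ∈ firstWeight (badWeights β ∪ {0, β.toWeight}) :=
      tens_mem_firstWeight (.inr (.inl rfl)) one_mem_weightSpace x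
    have mE (x : FPrime m n) : tens E x ∈ firstWeight (badWeights β ∪ {0, β.toWeight}) :=
      tens_mem_firstWeight (.inr (.inr rfl)) hE x
    have hΔz : Δ m n z ∈ firstWeight (badWeights β ∪ {0, β.toWeight}) := by
      rw [hT']
      exact add_mem (add_mem (m0 z) (Submodule.smul_mem _ _ (mE z')))
        (firstWeight_mono Set.subset_union_left ih)
    have t1 : R * Δ m n z ∈ firstWeight (badWeights β) :=
      mul_mem_firstWeight (fun μ hμ ν hν => add_mem_badWeights hμ hν) hΔ hΔz
    have t2 : (tens E 1 + tens 1 E) * T ∈ firstWeight (badWeights β) :=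
      mul_mem_firstWeight (fun μ hμ ν hν => add_comm ν μ ▸ add_mem_badWeights hν hμ)
        (add_mem (mE 1) (m0 E)) ih
    have t3 : tens (E * E) z' ∈ firstWeight (badWeights β) :=
      tens_mem_firstWeight hEE (mul_mem_weightSpace hE hE) _
    have key : Δ m n E * Δ m n z - tens 1 (E * z) - quantumInt β (k + 1) • tens E z =
        R * Δ m n z + (tens E 1 + tens 1 E) * T + quantumInt β k • tens (E * E) z' := by
      have e2 : tens 1 E * tens E z' = _ := one_tens_mul_tens hE hE z'
      have e3 : (tens E 1 + tens 1 E) * (tens 1 z + quantumInt β k • tens E z') =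
          tens E z + quantumInt β k • tens (E * E) z' + tens 1 (E * z) +
            twist β.toWeight β.toWeight • quantumInt β k • tens E z := by
        rw [add_mul, mul_add, mul_add, mul_smul_comm, mul_smul_comm, tens_one_mul_tens,
          tens_one_mul_tens, tens_mul_one_tens, e2, mul_one, smul_comm (quantumInt β k)
          (twist _ _), hpow]
        abel
      have e4 : Δ m n E * Δ m n z = R * Δ m n z + (tens E 1 + tens 1 E) * T +
          (tens E 1 + tens 1 E) * (tens 1 z + quantumInt β k • tens E z') := by
        rw [add_assoc, ← mul_add, add_comm T, ← hT', ← add_mul, add_comm R, ← hR']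
      rw [e4, e3, hq, add_smul, one_smul, mul_smul]
      abel
    rw [key]
    exact add_mem (add_mem t1 t2) (Submodule.smul_mem _ _ t3)

lemma form_rootVector_mul (β : PosRoot m n) (k : ℕ) (x : FPrime m n) {y : FPrime m n}
    (hy : y ∈ almostPrimitive β) :
    form m n (rootVector β * x) (rootVector β ^ k * y) =
      quantumInt β k * form m n (rootVector β) (rootVector β) *
        form m n x (rootVector β ^ (k - 1) * y) := by
  have h := squareForm_eq_zero_of_firstWeight (toWeight_notMem_badWeights β) (rootVector_mem β) x
    (Δ_rootVector_pow_mul β k hy)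
  rw [map_sub, map_sub, map_smul, squareForm_tens, squareForm_tens,
    form_eq_zero β.toWeight_ne_zero (rootVector_mem β) one_mem_weightSpace, zero_mul, sub_zero,
    sub_eq_zero] at h
  rw [form_mul_left, h, smul_eq_mul, mul_assoc]

/-! ### Nonvanishing of norms and orthogonality -/

lemma q_zpow_ne_one {k : ℤ} (hk : k ≠ 0) : q ^ k ≠ 1 := by
  rcases Int.natAbs_eq k with h | h
  · rw [h, zpow_natCast]; exact q_pow_ne_one (by omega)
  · rw [h, zpow_neg, zpow_natCast, ne_eq, inv_eq_one]; exact q_pow_ne_one (by omega)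

lemma quantumInt_ne_zero (β : PosRoot m n) {k : ℕ} (hk : k ≠ 0) (h : β.parity = 1 → k ≤ 1) :
    quantumInt β k ≠ 0 := by
  by_cases hβ : β.parity = 1
  · obtain rfl : k = 1 := by have := h hβ; omega
    simp [quantumInt]
  · have hp : ¬ (β.fst ≤ m ∧ m ≤ β.snd) := fun h' => hβ (by rw [β.parity_eq, if_pos h'])
    have hp0 : parity β.toWeight = 0 := by
      have := β.parity_eq
      rw [if_neg hp] at this
      exact this
    intro h0
    -- For an even root `t = q^(±2)` is not a root of unity, so the geometric sum cannot vanish.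
    have h1 := geom_sum_mul (twist β.toWeight β.toWeight) k
    rw [quantumInt] at h0
    rw [h0, zero_mul, twist, hp0, mul_zero, sgn_zero, mul_one, ← zpow_natCast, ← zpow_mul] at h1
    refine q_zpow_ne_one ?_ (sub_eq_zero.1 h1.symm)
    refine mul_ne_zero (neg_ne_zero.2 ?_) (by exact_mod_cast hk)
    rw [PosRoot.toWeight, bullet_segment_self β.one_le_fst β.fst_le_snd β.snd_le]
    have := β.fst_le_snd
    split_ifs <;> omega

lemma formCoeff_ne_zero (i : Idx m n) : formCoeff i ≠ 0 := by
  unfold formCoeff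
  split_ifs with h
  · exact one_ne_zero
  · refine one_div_ne_zero (sub_ne_zero.2 (Ne.symm (q_zpow_ne_one ?_)))
    rw [dot, if_pos rfl]
    split_ifs <;> omega

/-- Write `F = E θ_j - c θ_j E`. The pairing of `F` with `E θ_j` vanishes, since no term of `Δ(F)`
pairs with `E ⊗ θ_j`. Since `D_j F = (c⁻¹ - c) E`, this gives `(F, F) = -c (θ_j, θ_j) (c⁻¹ - c) (E,
E)`, and `c = q^(±1)` has `c² ≠ 1`. -/
lemma form_rootVectorAux_ne_zero {i d : ℕ} (hi : 1 ≤ i) (hd : i + d ≤ m + n - 1) :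
    form m n (rootVectorAux m n i d) (rootVectorAux m n i d) ≠ 0 := by
  induction d with
  | zero =>
    rw [rootVectorAux, gen_eq (Finset.mem_Icc.2 ⟨hi, hd⟩), form_theta_theta, if_pos rfl]
    exact formCoeff_ne_zero _
  | succ d ih =>
    have hE := rootVectorAux_mem (m := m) (n := n) i d
    have hF := rootVectorAux_mem (m := m) (n := n) i (d + 1)
    have hj : i + d + 1 ∈ Finset.Icc 1 (m + n - 1) := Finset.mem_Icc.2 ⟨by omega, hd⟩
    have hR := Δ_rootVectorAux hi hd
    have hc := braidCoeff_mul_twist hi hd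
    have hEne : segment m n i (i + d) ≠ 0 := segment_ne_zero hi (by omega) (by omega)
    have hEabove : segment m n i (i + d) ∉ weightsAbove m n i := fun h => by
      have := h.2 ⟨i, Finset.mem_Icc.2 ⟨hi, by omega⟩⟩ le_rfl
      simp [segment] at this
    set F := rootVectorAux m n i (d + 1) with hFdef
    rw [rootVectorAux_succ, qBracket, gen_eq hj] at hFdef
    set E := rootVectorAux m n i d
    set c := braidCoeff m q (i + d + 1) with hcdef
    have hseg := segment_self (m := m) (n := n) hj
    set j : Idx m n := ⟨i + d + 1, hj⟩
    rw [hseg] at hc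
    have h1 : form m n F (E * θ j) = 0 := by
      have h2 := squareForm_eq_zero_of_firstWeight hEabove hE (θ j) hR
      rw [map_sub, map_sub, squareForm_tens, squareForm_tens,
        form_eq_zero hEne hE one_mem_weightSpace, zero_mul, sub_zero,
        form_comm (θ j), form_theta_right, deriv_one, map_zero, mul_zero, mul_zero, sub_zero] at h2
      rw [form_mul_right, squareForm_form_comm, h2]
    have h2 : deriv j E = 0 := by
      refine deriv_eq_zero ?_ hE
      exact if_neg (by simp only [j]; omega)
    have h3 : deriv j F = (twist (simple j) (segment m n i (i + d)) - c) • E := by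
      rw [hFdef, map_sub, map_smul, deriv_mul j hE, deriv_theta_mul, h2, deriv_theta]
      simp [sub_smul]
    have h4 : form m n F F = -c * formCoeff j *
        (twist (simple j) (segment m n i (i + d)) - c) * form m n E E := by
      have h5 : form m n F F = form m n F (E * θ j - c • (θ j * E)) := by rw [← hFdef]
      rw [h5, map_sub, h1, map_smul, form_theta_mul, h3, map_smul, LinearMap.smul_apply,
        smul_eq_mul, smul_eq_mul]
      ring
    have hc0 : c ≠ 0 := left_ne_zero_of_mul_eq_one hc
    rw [h4, eq_inv_of_mul_eq_one_right hc]
    refine mul_ne_zero (mul_ne_zero (mul_ne_zero (neg_ne_zero.2 hc0) (formCoeff_ne_zero j)) ?_)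
      (ih (by omega))
    intro h
    have h5 : c ^ 2 = 1 := by
      have h6 : c⁻¹ = c := sub_eq_zero.1 h
      rw [pow_two]; nth_rewrite 1 [← h6]; exact inv_mul_cancel₀ hc0
    rw [hcdef, braidCoeff] at h5
    split_ifs at h5
    · rw [inv_pow, inv_eq_one] at h5
      exact q_pow_ne_one two_ne_zero h5
    · exact q_pow_ne_one two_ne_zero h5

lemma form_rootVector_ne_zero (α : PosRoot m n) :
    form m n (rootVector α) (rootVector α) ≠ 0 :=
  form_rootVectorAux_ne_zero α.one_le_fst (by
    rw [Nat.add_sub_cancel' α.fst_le_snd]; exact α.snd_le)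

lemma form_rootVector_pow_mul_ne_zero_iff (β : PosRoot m n) {a b : ℕ}
    (ha : β.parity = 1 → a ≤ 1) (hb : β.parity = 1 → b ≤ 1) {x y : FPrime m n}
    (hx : x ∈ almostPrimitive β) (hy : y ∈ almostPrimitive β) :
    form m n (rootVector β ^ a * x) (rootVector β ^ b * y) ≠ 0 ↔
      a = b ∧ form m n x y ≠ 0 := by
  induction a generalizing b with
  | zero =>
    cases b with
    | zero => simp
    | succ b =>
      rw [form_comm, pow_succ', mul_assoc, form_rootVector_mul β 0 _ hx]
      simp [quantumInt]
  | succ a ih =>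
    rw [pow_succ', mul_assoc, form_rootVector_mul β b _ hy]
    cases b with
    | zero => simp [quantumInt]
    | succ b =>
      rw [Nat.add_sub_cancel, mul_ne_zero_iff, mul_ne_zero_iff,
        ih (fun h => by have := ha h; omega) (fun h => by have := hb h; omega), Nat.succ_inj]
      exact and_iff_right ⟨quantumInt_ne_zero β (Nat.succ_ne_zero b) hb,
        form_rootVector_ne_zero β⟩

lemma form_list_prod_ne_zero_iff {L : List (PosRoot m n)} (hL : L.Pairwise (· < ·))
    (e e' : PBWExponent m n) :
    form m n (L.map fun α => rootVector α ^ e.1 α).prod (L.map fun α => rootVector α ^ e'.1 α).prod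
      ≠ 0 ↔ ∀ α ∈ L, e.1 α = e'.1 α := by
  induction L with
  | nil => simp [form_apply_one]
  | cons β L ih =>
    rw [List.pairwise_cons] at hL
    have hmem (f : PosRoot m n → ℕ) :
        (L.map fun α => rootVector α ^ f α).prod ∈ almostPrimitive β := by
      refine Submonoid.list_prod_mem _ fun x hx => ?_
      obtain ⟨α, hα, rfl⟩ := List.mem_map.1 hx
      exact pow_mem (rootVector_mem_almostPrimitive (hL.1 α hα)) _
    simp only [List.map_cons, List.prod_cons, List.forall_mem_cons]
    rw [form_rootVector_pow_mul_ne_zero_iff β (e.2 β) (e'.2 β) (hmem _) (hmem _), ih hL.2]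

lemma form_pbwMonomial_ne_zero_iff (e e' : PBWExponent m n) :
    form m n (pbwMonomial e.1) (pbwMonomial e'.1) ≠ 0 ↔ e = e' := by
  rw [pbwMonomial, pbwMonomial, form_list_prod_ne_zero_iff (Finset.sortedLT_sort _).pairwise,
    Subtype.ext_iff, funext_iff]
  simp

/-! ### The PBW basis -/

lemma linearCombination_eq_zero_of_mem_radical (c : PBWExponent m n →₀ Kq)
    (h : Finsupp.linearCombination Kq (fun e : PBWExponent m n => pbwMonomial e.1) c ∈
      radical (form_isLusztigForm m n)) : c = 0 := by
  ext e
  have h1 := (mem_radical _ _).1 h (pbwMonomial e.1)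
  rw [Finsupp.linearCombination_apply, Finsupp.sum, map_sum, LinearMap.sum_apply,
    Finset.sum_eq_single e] at h1
  · rw [map_smul, LinearMap.smul_apply, smul_eq_mul, mul_eq_zero] at h1
    exact h1.resolve_right ((form_pbwMonomial_ne_zero_iff e e).2 rfl)
  · intro e' _ he
    rw [map_smul, LinearMap.smul_apply,
      not_not.1 (mt (form_pbwMonomial_ne_zero_iff e' e).1 he), smul_zero]
  · intro he
    rw [Finsupp.notMem_support_iff.1 he, zero_smul, map_zero, LinearMap.zero_apply]

lemma toFAlg_eq_zero_iff {B : LinearMap.BilinForm Kq (FPrime m n)} (hB : IsLusztigForm B)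
    (x : FPrime m n) : toFAlg hB x = 0 ↔ x ∈ radical hB := by
  rw [← map_zero (toFAlg hB), ← sub_zero x, ← TwoSidedIdeal.rel_iff, sub_zero]
  exact (radical hB).ringCon.eq

lemma exists_sub_linearCombination_mem_serreIdeal (x : FPrime m n) :
    ∃ c : PBWExponent m n →₀ Kq,
      x - Finsupp.linearCombination Kq (fun e : PBWExponent m n => pbwMonomial e.1) c ∈
        serreIdeal m n := by
  obtain ⟨y, hy, h⟩ := exists_sub_mem_serreIdeal x
  obtain ⟨c, rfl⟩ := (Finsupp.mem_span_range_iff_exists_finsupp).1 hy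
  exact ⟨c, h⟩

/-- A PBW combination congruent to a radical element modulo the Serre ideal is itself in the
radical, hence zero by orthogonality. -/
lemma radical_eq_serreIdeal : radical (form_isLusztigForm m n) = serreIdeal m n := by
  refine le_antisymm (fun x hx => ?_) serreIdeal_le_radical
  obtain ⟨c, hc⟩ := exists_sub_linearCombination_mem_serreIdeal x
  have h : c = 0 := by
    refine linearCombination_eq_zero_of_mem_radical c ?_
    have := sub_mem hx (serreIdeal_le_radical hc)
    rwa [sub_sub_cancel] at this
  rwa [h, map_zero, sub_zero] at hc

lemma exists_basis_pbwMonomial :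
    ∃ b : Module.Basis (PBWExponent m n) Kq (FAlg (form_isLusztigForm m n)),
      ∀ e : PBWExponent m n, b e = toFAlg (form_isLusztigForm m n) (pbwMonomial e.1) := by
  have hcomp (c : PBWExponent m n →₀ Kq) : Finsupp.linearCombination Kq
      (fun e : PBWExponent m n => toFAlg (form_isLusztigForm m n) (pbwMonomial e.1)) c =
      toFAlg (form_isLusztigForm m n)
        (Finsupp.linearCombination Kq (fun e : PBWExponent m n => pbwMonomial e.1) c) := by
    simp [Finsupp.linearCombination_apply, Finsupp.sum]
  have hli : LinearIndependent Kq fun e : PBWExponent m n =>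
      toFAlg (form_isLusztigForm m n) (pbwMonomial e.1) := by
    rw [linearIndependent_iff]
    intro c hc
    rw [hcomp, toFAlg_eq_zero_iff] at hc
    exact linearCombination_eq_zero_of_mem_radical c hc
  have hsp : ⊤ ≤ Submodule.span Kq (Set.range fun e : PBWExponent m n =>
      toFAlg (form_isLusztigForm m n) (pbwMonomial e.1)) := by
    rintro x -
    obtain ⟨x, rfl⟩ : ∃ y, toFAlg (form_isLusztigForm m n) y = x :=
      (radical (form_isLusztigForm m n)).ringCon.mk'_surjective x
    obtain ⟨c, hc⟩ := exists_sub_linearCombination_mem_serreIdeal x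
    have h := (toFAlg_eq_zero_iff (form_isLusztigForm m n) _).2 (serreIdeal_le_radical hc)
    rw [map_sub, sub_eq_zero] at h
    rw [h, ← hcomp]
    exact (Finsupp.mem_span_range_iff_exists_finsupp).2 ⟨c, rfl⟩
  exact ⟨Module.Basis.mk hli hsp, fun e => Module.Basis.mk_apply hli hsp e⟩

end SuperPBW

end

theorem mainTheorem9 (m n : ℕ) :
    (∃! B : LinearMap.BilinForm SuperPBW.Kq (SuperPBW.FPrime m n), SuperPBW.IsLusztigForm B) ∧
    ∀ (B : LinearMap.BilinForm SuperPBW.Kq (SuperPBW.FPrime m n)) (hB : SuperPBW.IsLusztigForm B),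
      (∃ b : Module.Basis (SuperPBW.PBWExponent m n) SuperPBW.Kq (SuperPBW.FAlg hB),
        ∀ e : SuperPBW.PBWExponent m n,
          b e = SuperPBW.toFAlg hB (SuperPBW.pbwMonomial e.1)) ∧
      SuperPBW.radical hB = SuperPBW.serreIdeal m n := by
  refine ⟨⟨SuperPBW.form m n, SuperPBW.form_isLusztigForm m n, fun B hB =>
    hB.unique (SuperPBW.form_isLusztigForm m n)⟩, fun B hB => ?_⟩
  obtain rfl := hB.unique (SuperPBW.form_isLusztigForm m n)
  exact ⟨SuperPBW.exists_basis_pbwMonomial, SuperPBW.radical_eq_serreIdeal⟩
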